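/- Let $\alpha,\beta\in\mathbb C$ satisfy $\alpha+n+m\beta\neq 0$ for all nonzero integers $m,n$. Let $\mathcal L$ be the extended Heisenberg--Virasoro algebra with parameters $\alpha,\beta$ and $F=0$, i.e. the complex Lie algebra with basis $L_m,J_m,G_m$ ($m\in\mathbb Z$), $C_1,C_2,C_3$, where $C_1,C_2,C_3$ are central and, for $m,n\in\mathbb Z$, $$[L_m,L_n]=(m-n)L_{m+n}+\tfrac{m^3-m}{12}\delta_{m+n,0}C_1,\qquad [L_m,J_n]=-nJ_{m+n}-(m^2+m)\delta_{m+n,0}C_2,$$ $$[J_m,J_n]=m\,\delta_{m+n,0}C_3,\qquad [L_m,G_n]=-(\alpha+n+m\beta)G_{m+n},\qquad [J_m,G_n]=0,\qquad [G_m,G_n]=0.$$ For integers $d_1,d_2\ge 0$ and $\underline d=(d_1,d_2)$ let $\mathcal L_{\underline d}$ be the Lie subalgebra of $\mathcal L$ spanned by $G_{-d_1+i}$, $J_{-d_2+i}$, $L_i$ ($i\ge 0$) and $C_1,C_2,C_3$. Let $V$ be a simple $\mathcal L_{\underline d}$-module on which $C_3$ acts as a nonzero scalar. Suppose that there is an integer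 $k\ge 0$ such that (a) $G_k$ acts injectively on $V$, and (b) $G_{k+i}V=J_{d_2+i}V=L_{k+d_1+i}V=0$ for all integers $i\ge 1$. Then the induced module $\mathrm{Ind}_{\mathcal L_{\underline d}}^{\mathcal L}(V)=U(\mathcal L)\otimes_{U(\mathcal L_{\underline d})}V$ is a simple $\mathcal L$-module. -/

import Mathlib

open scoped TensorProduct

/-! ### Induced modules over Lie algebras -/

attribute [local instance 100] LieRing.ofAssociativeRing in
/-- The algebra map `U(𝔥) → U(𝔤)` coming from the inclusion of a Lie subalgebra `𝔥` of `𝔤`. -/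
noncomputable def LieSubalgebra.envelopingMap {R 𝔤 : Type*} [CommRing R] [LieRing 𝔤]
    [LieAlgebra R 𝔤] (𝔥 : LieSubalgebra R 𝔤) :
    UniversalEnvelopingAlgebra R 𝔥 →ₐ[R] UniversalEnvelopingAlgebra R 𝔤 :=
  UniversalEnvelopingAlgebra.lift R ((UniversalEnvelopingAlgebra.ι R).comp 𝔥.incl)

/-- The action of `U(𝔥)` on an `𝔥`-module `V`. -/
noncomputable def LieModule.envelopingAction (R 𝔥 V : Type*) [CommRing R] [LieRing 𝔥]
    [LieAlgebra R 𝔥] [AddCommGroup V] [Module R V] [LieRingModule 𝔥 V] [LieModule R 𝔥 V] :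
    UniversalEnvelopingAlgebra R 𝔥 →ₐ[R] Module.End R V :=
  UniversalEnvelopingAlgebra.lift R (LieModule.toEnd R 𝔥 V)

section Induced

variable {R 𝔤 : Type*} [CommRing R] [LieRing 𝔤] [LieAlgebra R 𝔤] (𝔥 : LieSubalgebra R 𝔤)
  (V : Type*) [AddCommGroup V] [Module R V] [LieRingModule 𝔥 V] [LieModule R 𝔥 V]

/-- The `U(𝔤)`-submodule of `U(𝔤) ⊗[R] V` generated by the elements `u y ⊗ v - u ⊗ y v`
with `u ∈ U(𝔤)`, `y ∈ U(𝔥)`, `v ∈ V`. -/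
noncomputable def LieModule.balancedRelations :
    Submodule (UniversalEnvelopingAlgebra R 𝔤) (UniversalEnvelopingAlgebra R 𝔤 ⊗[R] V) :=
  Submodule.span _ {t | ∃ (u : UniversalEnvelopingAlgebra R 𝔤)
    (y : UniversalEnvelopingAlgebra R 𝔥) (v : V),
    t = (u * 𝔥.envelopingMap y) ⊗ₜ[R] v - u ⊗ₜ[R] (LieModule.envelopingAction R 𝔥 V y v)}

/-- The induced module `U(𝔤) ⊗_{U(𝔥)} V`. -/
def LieModule.Ind : Type _ :=
  (UniversalEnvelopingAlgebra R 𝔤 ⊗[R] V) ⧸ LieModule.balancedRelations 𝔥 V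

namespace LieModule.Ind

noncomputable instance : AddCommGroup (LieModule.Ind 𝔥 V) :=
  inferInstanceAs (AddCommGroup
    ((UniversalEnvelopingAlgebra R 𝔤 ⊗[R] V) ⧸ LieModule.balancedRelations 𝔥 V))

noncomputable instance : Module (UniversalEnvelopingAlgebra R 𝔤) (LieModule.Ind 𝔥 V) :=
  inferInstanceAs (Module (UniversalEnvelopingAlgebra R 𝔤)
    ((UniversalEnvelopingAlgebra R 𝔤 ⊗[R] V) ⧸ LieModule.balancedRelations 𝔥 V))

noncomputable instance : Module R (LieModule.Ind 𝔥 V) :=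
  inferInstanceAs (Module R
    ((UniversalEnvelopingAlgebra R 𝔤 ⊗[R] V) ⧸ LieModule.balancedRelations 𝔥 V))

instance : IsScalarTower R (UniversalEnvelopingAlgebra R 𝔤) (LieModule.Ind 𝔥 V) :=
  inferInstanceAs (IsScalarTower R (UniversalEnvelopingAlgebra R 𝔤)
    ((UniversalEnvelopingAlgebra R 𝔤 ⊗[R] V) ⧸ LieModule.balancedRelations 𝔥 V))

/-- `𝔤` acts through `U(𝔤)`, that is, by left multiplication on the first tensor factor. -/
noncomputable instance : LieRingModule 𝔤 (LieModule.Ind 𝔥 V) where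
  bracket x w := UniversalEnvelopingAlgebra.ι R x • w
  add_lie x y w := by
    change UniversalEnvelopingAlgebra.ι R (x + y) • w = _
    rw [map_add, add_smul]
  lie_add x v w := smul_add _ _ _
  leibniz_lie x y w := by
    change UniversalEnvelopingAlgebra.ι R x • UniversalEnvelopingAlgebra.ι R y • w =
      UniversalEnvelopingAlgebra.ι R ⁅x, y⁆ • w +
        UniversalEnvelopingAlgebra.ι R y • UniversalEnvelopingAlgebra.ι R x • w
    let _ : LieRing (UniversalEnvelopingAlgebra R 𝔤) := LieRing.ofAssociativeRing
    rw [LieHom.map_lie, LieRing.of_associative_ring_bracket, sub_smul, mul_smul, mul_smul,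
      sub_add_cancel]

instance : LieModule R 𝔤 (LieModule.Ind 𝔥 V) where
  smul_lie r x w := by
    change UniversalEnvelopingAlgebra.ι R (r • x) • w = r • UniversalEnvelopingAlgebra.ι R x • w
    rw [map_smul, smul_assoc]
  lie_smul r x w := by
    change UniversalEnvelopingAlgebra.ι R x • r • w = r • UniversalEnvelopingAlgebra.ι R x • w
    rw [← algebraMap_smul (UniversalEnvelopingAlgebra R 𝔤) r w,
      ← algebraMap_smul (UniversalEnvelopingAlgebra R 𝔤) r
        (UniversalEnvelopingAlgebra.ι R x • w), ← mul_smul, ← mul_smul, Algebra.commutes]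

end LieModule.Ind

end Induced

/-! ### The extended Heisenberg-Virasoro algebra -/

/-- Labels of the basis `L_m, J_m, G_m` (`m ∈ ℤ`), `C₁, C₂, C₃`. -/
inductive EHVIndex : Type
  | L (m : ℤ)
  | J (m : ℤ)
  | G (m : ℤ)
  | C₁
  | C₂
  | C₃

/-- The underlying vector space of the extended Heisenberg-Virasoro algebra with parameters
`α, β, F`: the complex vector space with basis `L_m, J_m, G_m, C₁, C₂, C₃`. -/
def EHV (_α _β _F : ℂ) : Type := EHVIndex →₀ ℂ

namespace EHV

noncomputable instance (α β F : ℂ) : AddCommGroup (EHV α β F) :=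
  inferInstanceAs (AddCommGroup (EHVIndex →₀ ℂ))

noncomputable instance (α β F : ℂ) : Module ℂ (EHV α β F) :=
  inferInstanceAs (Module ℂ (EHVIndex →₀ ℂ))

/-- The basis of `EHV α β F` indexed by `EHVIndex`. -/
noncomputable def basis (α β F : ℂ) : Module.Basis EHVIndex ℂ (EHV α β F) :=
  Module.Basis.ofRepr (LinearEquiv.refl ℂ (EHVIndex →₀ ℂ))

section

variable (α β F : ℂ)

/-- The basis vector `L_m`. -/
noncomputable def L (m : ℤ) : EHV α β F := basis α β F (.L m)

/-- The basis vector `J_m`. -/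
noncomputable def J (m : ℤ) : EHV α β F := basis α β F (.J m)

/-- The basis vector `G_m`. -/
noncomputable def G (m : ℤ) : EHV α β F := basis α β F (.G m)

/-- The central basis vector `C₁`. -/
noncomputable def C₁ : EHV α β F := basis α β F .C₁

/-- The central basis vector `C₂`. -/
noncomputable def C₂ : EHV α β F := basis α β F .C₂

/-- The central basis vector `C₃`. -/
noncomputable def C₃ : EHV α β F := basis α β F .C₃

/-- The Lie brackets of the basis vectors. -/
noncomputable def basisBracket : EHVIndex → EHVIndex → EHV α β F
  | .L m, .L n => ((m : ℂ) - n) • L α β F (m + n) +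
      (if m + n = 0 then ((m : ℂ) ^ 3 - m) / 12 else 0) • C₁ α β F
  | .L m, .J n => (-(n : ℂ)) • J α β F (m + n) -
      (if m + n = 0 then (m : ℂ) ^ 2 + m else 0) • C₂ α β F
  | .J n, .L m => (n : ℂ) • J α β F (m + n) +
      (if m + n = 0 then (m : ℂ) ^ 2 + m else 0) • C₂ α β F
  | .L m, .G n => (-(α + n + m * β)) • G α β F (m + n)
  | .G n, .L m => (α + n + m * β) • G α β F (m + n)
  | .J m, .J n => (if m + n = 0 then (m : ℂ) else 0) • C₃ α β F
  | .J m, .G n => F • G α β F (m + n)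
  | .G n, .J m => (-F) • G α β F (m + n)
  | _, _ => 0

/-- The bilinear extension of the brackets of the basis vectors. -/
noncomputable def bracketMap : EHV α β F →ₗ[ℂ] EHV α β F →ₗ[ℂ] EHV α β F :=
  (basis α β F).constr ℂ fun a => (basis α β F).constr ℂ fun b => basisBracket α β F a b

noncomputable instance : Bracket (EHV α β F) (EHV α β F) where
  bracket x y := bracketMap α β F x y

theorem lie_basis (a b : EHVIndex) :
    ⁅basis α β F a, basis α β F b⁆ = basisBracket α β F a b := by
  change bracketMap α β F _ _ = _
  simp [bracketMap]

theorem bracketMap_basis (a b : EHVIndex) :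
    bracketMap α β F (basis α β F a) (basis α β F b) = basisBracket α β F a b := by
  simp [bracketMap]

theorem basisBracket_skew (a b : EHVIndex) :
    basisBracket α β F a b = -basisBracket α β F b a := by
  rcases a with m | m | m | _ | _ | _ <;> rcases b with n | n | n | _ | _ | _ <;>
    simp only [basisBracket, neg_zero]
  all_goals try rw [add_comm n m]
  all_goals
    by_cases h : m + n = 0
    · obtain rfl : n = -m := by omega
      try simp only [h, if_true]
      push_cast
      module
    · try simp only [h, if_false]
      module

theorem bracketMap_self (x : EHV α β F) : bracketMap α β F x x = 0 := by
  have h : bracketMap α β F = -(bracketMap α β F).flip := by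
    refine (basis α β F).ext fun a => (basis α β F).ext fun b => ?_
    simp only [LinearMap.neg_apply, LinearMap.flip_apply, bracketMap_basis]
    exact basisBracket_skew α β F a b
  have hx := LinearMap.congr_fun (LinearMap.congr_fun h x) x
  simp only [LinearMap.neg_apply, LinearMap.flip_apply] at hx
  have h2 : (2 : ℂ) • bracketMap α β F x x = 0 := by
    rw [two_smul]
    exact add_eq_zero_iff_eq_neg.mpr hx
  exact (smul_eq_zero.mp h2).resolve_left two_ne_zero

theorem bracketMap_leibniz_basis (a b c : EHVIndex) :
    bracketMap α β F (basis α β F a) (basisBracket α β F b c) =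
      bracketMap α β F (basisBracket α β F a b) (basis α β F c) +
        bracketMap α β F (basis α β F b) (basisBracket α β F a c) := by
  rcases a with m | m | m | _ | _ | _ <;> rcases b with n | n | n | _ | _ | _ <;>
    rcases c with p | p | p | _ | _ | _ <;>
    simp only [basisBracket, L, J, G, C₁, C₂, C₃, map_add, map_sub, map_smul, map_zero,
      LinearMap.add_apply, LinearMap.sub_apply, LinearMap.smul_apply, LinearMap.zero_apply,
      bracketMap_basis, smul_zero, add_zero, sub_zero, zero_add]
  all_goals try simp only [show m + (n + p) = m + n + p by ring, show m + (p + n) = m + n + p by ring,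
      show n + (m + p) = m + n + p by ring, show n + (p + m) = m + n + p by ring,
      show p + (m + n) = m + n + p by ring, show p + (n + m) = m + n + p by ring,
      show m + p + n = m + n + p by ring, show n + m + p = m + n + p by ring,
      show n + p + m = m + n + p by ring, show p + m + n = m + n + p by ring,
      show p + n + m = m + n + p by ring]
  all_goals
    by_cases h : m + n + p = 0
    · obtain rfl : p = -m - n := by omega
      try simp only [h, if_true]
      push_cast
      module
    · try simp only [h, if_false]
      push_cast
      module

theorem bracketMap_leibniz (x y z : EHV α β F) :
    bracketMap α β F x (bracketMap α β F y z) =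
      bracketMap α β F (bracketMap α β F x y) z +
        bracketMap α β F y (bracketMap α β F x z) := by
  let B := bracketMap α β F
  have h₁ (a b : EHVIndex) (z : EHV α β F) : B (basis α β F a) (B (basis α β F b) z) =
      B (B (basis α β F a) (basis α β F b)) z + B (basis α β F b) (B (basis α β F a) z) := by
    have : B (basis α β F a) ∘ₗ B (basis α β F b) =
        B (B (basis α β F a) (basis α β F b)) + B (basis α β F b) ∘ₗ B (basis α β F a) := by
      refine (basis α β F).ext fun c => ?_
      simp only [LinearMap.comp_apply, LinearMap.add_apply, B, bracketMap_basis]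
      exact bracketMap_leibniz_basis α β F a b c
    exact LinearMap.congr_fun this z
  have h₂ (a : EHVIndex) (y z : EHV α β F) : B (basis α β F a) (B y z) =
      B (B (basis α β F a) y) z + B y (B (basis α β F a) z) := by
    have : B (basis α β F a) ∘ₗ B.flip z =
        B.flip z ∘ₗ B (basis α β F a) + B.flip (B (basis α β F a) z) :=
      (basis α β F).ext fun b => h₁ a b z
    exact LinearMap.congr_fun this y
  have : B.flip (B y z) = B.flip z ∘ₗ B.flip y + B y ∘ₗ B.flip z :=
    (basis α β F).ext fun a => h₂ a y z
  exact LinearMap.congr_fun this x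

noncomputable instance : LieRing (EHV α β F) where
  add_lie x y z := by
    change bracketMap α β F _ _ = bracketMap α β F _ _ + bracketMap α β F _ _
    simp
  lie_add x y z := map_add (bracketMap α β F x) y z
  lie_self := bracketMap_self α β F
  leibniz_lie := bracketMap_leibniz α β F

noncomputable instance : LieAlgebra ℂ (EHV α β F) where
  lie_smul t x y := map_smul (bracketMap α β F x) t y

end

/-- The labels of `G_{-d₁+i}`, `J_{-d₂+i}`, `L_i` (`i ≥ 0`) and `C₁, C₂, C₃`. -/
def parabolicIndex (d₁ d₂ : ℕ) : Set EHVIndex :=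
  {a | match a with
    | .L m => 0 ≤ m
    | .J m => -(d₂ : ℤ) ≤ m
    | .G m => -(d₁ : ℤ) ≤ m
    | _ => True}

/-- For `F = 0`, the Lie subalgebra spanned by `G_{-d₁+i}`, `J_{-d₂+i}`, `L_i` (`i ≥ 0`) and
`C₁, C₂, C₃`. -/
noncomputable def parabolic (α β : ℂ) (d₁ d₂ : ℕ) : LieSubalgebra ℂ (EHV α β 0) where
  toSubmodule := Submodule.span ℂ (basis α β 0 '' parabolicIndex d₁ d₂)
  lie_mem' := by
    intro x y hx hy
    simp only [AddSubsemigroup.mem_carrier, AddSubmonoid.mem_toSubsemigroup,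
      Submodule.mem_toAddSubmonoid] at hx hy ⊢
    refine Submodule.span_induction₂ (p := fun x y _ _ =>
      ⁅x, y⁆ ∈ Submodule.span ℂ (basis α β 0 '' parabolicIndex d₁ d₂)) ?_ ?_ ?_ ?_ ?_ ?_ ?_ hx hy
    · rintro _ _ ⟨a, ha, rfl⟩ ⟨b, hb, rfl⟩
      rw [lie_basis]
      have key : ∀ c ∈ parabolicIndex d₁ d₂, ∀ t : ℂ, t • basis α β 0 c ∈
          Submodule.span ℂ (basis α β 0 '' parabolicIndex d₁ d₂) := fun c hc t =>
        Submodule.smul_mem _ t (Submodule.subset_span ⟨c, hc, rfl⟩)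
      rcases a with m | m | m | _ | _ | _ <;> rcases b with n | n | n | _ | _ | _ <;>
        simp only [basisBracket, neg_zero, zero_smul, Submodule.zero_mem]
      all_goals simp only [parabolicIndex, Set.mem_ofPred_eq] at ha hb
      all_goals first
        | exact key _ (by simp only [parabolicIndex, Set.mem_ofPred_eq]; try omega) _
        | exact Submodule.add_mem _
            (key _ (by simp only [parabolicIndex, Set.mem_ofPred_eq]; try omega) _)
            (key _ (by simp only [parabolicIndex, Set.mem_ofPred_eq]) _)
        | exact Submodule.sub_mem _
            (key _ (by simp only [parabolicIndex, Set.mem_ofPred_eq]; try omega) _)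
            (key _ (by simp only [parabolicIndex, Set.mem_ofPred_eq]) _)
    · intro y _
      simp
    · intro x _
      simp
    · intro x y z _ _ _ h₁ h₂
      rw [add_lie]
      exact Submodule.add_mem _ h₁ h₂
    · intro x y z _ _ _ h₁ h₂
      rw [lie_add]
      exact Submodule.add_mem _ h₁ h₂
    · intro r x y _ _ h
      rw [smul_lie]
      exact Submodule.smul_mem _ r h
    · intro r x y _ _ h
      rw [lie_smul]
      exact Submodule.smul_mem _ r h

variable {α β : ℂ} {d₁ d₂ : ℕ}

theorem L_mem_parabolic {m : ℤ} (h : 0 ≤ m) : L α β 0 m ∈ parabolic α β d₁ d₂ :=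
  Submodule.subset_span ⟨.L m, h, rfl⟩

theorem J_mem_parabolic {m : ℤ} (h : -(d₂ : ℤ) ≤ m) : J α β 0 m ∈ parabolic α β d₁ d₂ :=
  Submodule.subset_span ⟨.J m, h, rfl⟩

theorem G_mem_parabolic {m : ℤ} (h : -(d₁ : ℤ) ≤ m) : G α β 0 m ∈ parabolic α β d₁ d₂ :=
  Submodule.subset_span ⟨.G m, h, rfl⟩

theorem C₃_mem_parabolic : C₃ α β 0 ∈ parabolic α β d₁ d₂ :=
  Submodule.subset_span ⟨.C₃, trivial, rfl⟩

end EHV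

/-!
Let `W` be a submodule of the induced module which meets `1 ⊗ V` trivially; one shows `W = 0`. The
induced module is reached from `1 ⊗ V` by adjoining first the operators `G_n` with `n < -d₁`, then
the `J_n` with `n < -d₂`, and last the `L_n` with `n < 0`, and `W` remains disjoint from the space
obtained at each step. For the three families of raising operators, lowering operators which
preserve `W` are respectively the `L_n` with `n > k + d₁`, the `J_n` with `n > d₂` and the `G_n`
with `n > k`. The commutator of a raising operator with its partner is a nonzero multiple of `G_k`,
`C₃` and `G_k` respectively, all of which act injectively: the coefficient is nonzero by the
assumption on `α` and `β` in the two steps which involve `G`, and because `J_n` is paired with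
`J_{-n}`, `n ≠ 0`, in the second. As in a Heisenberg algebra, lowering `w ∈ W` therefore detects
the coefficients of its expansion in powers of a raising operator, so `w = 0` by induction on the
degree. The operators `L_n` commute only up to terms of lower degree, so for the third step the
argument is applied to the associated graded space of the filtration by the number of factors.

That `V` embeds in the induced module is usually deduced from the Poincaré–Birkhoff–Witt theorem.
Here the parabolic subalgebra has a complement `𝔫` which is a subalgebra, and the formula
`z (x w) = x (z w) - [x, z] w` for `x ∈ 𝔫` extends the obvious operators on `1 ⊗ V` to an action of
the whole algebra on `U(𝔫) ⊗ V`. Its curvature vanishes because it vanishes on `1 ⊗ V` and is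
compatible with the action of `𝔫`.
-/

namespace EnvelopingAlgebra

variable {R L : Type*} [CommRing R] [LieRing L] [LieAlgebra R L]

theorem adjoin_range_ι :
    Algebra.adjoin R (Set.range (UniversalEnvelopingAlgebra.ι R : L → _)) = ⊤ := by
  have hs : Function.Surjective (UniversalEnvelopingAlgebra.mkAlgHom R L) :=
    RingCon.mk'_surjective _
  have h := congrArg (Subalgebra.map (UniversalEnvelopingAlgebra.mkAlgHom R L))
    (TensorAlgebra.adjoin_range_ι (R := R) (M := L))
  rwa [AlgHom.map_adjoin, Algebra.map_top, (AlgHom.range_eq_top _).mpr hs, ← Set.range_comp] at h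

theorem eq_top_of_one_mem_of_ι_mul_mem {S : Submodule R (UniversalEnvelopingAlgebra R L)}
    (one_mem : 1 ∈ S) (ι_mul_mem : ∀ x : L, ∀ u ∈ S, UniversalEnvelopingAlgebra.ι R x * u ∈ S) :
    S = ⊤ := by
  have mul_mem : ∀ u, ∀ s ∈ S, u * s ∈ S := by
    intro u
    have hu : u ∈ Algebra.adjoin R (Set.range (UniversalEnvelopingAlgebra.ι R : L → _)) :=
      adjoin_range_ι (R := R) (L := L) ▸ Algebra.mem_top
    induction hu using Algebra.adjoin_induction with
    | mem x hx =>
      obtain ⟨y, rfl⟩ := hx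
      exact ι_mul_mem y
    | algebraMap r => exact fun s hs => Algebra.smul_def r s ▸ S.smul_mem r hs
    | add x y _ _ hx hy => exact fun s hs => add_mul x y s ▸ S.add_mem (hx s hs) (hy s hs)
    | mul x y _ _ hx hy => exact fun s hs => (mul_assoc x y s).symm ▸ hx _ (hy s hs)
  exact eq_top_iff.2 fun u _ => mul_one u ▸ mul_mem u 1 one_mem

theorem tensor_eq_top_of_one_tmul_mem_of_ι_smul_mem {V : Type*} [AddCommGroup V] [Module R V]
    {S : Submodule R (UniversalEnvelopingAlgebra R L ⊗[R] V)} (one_tmul_mem : ∀ v : V, 1 ⊗ₜ v ∈ S)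
    (ι_smul_mem : ∀ x : L, ∀ w ∈ S, UniversalEnvelopingAlgebra.ι R x • w ∈ S) : S = ⊤ := by
  refine eq_top_iff.2 fun w _ => ?_
  induction w with
  | zero => exact S.zero_mem
  | add a b ha hb => exact S.add_mem (ha trivial) (hb trivial)
  | tmul u v =>
    have h := eq_top_of_one_mem_of_ι_mul_mem
      (S := S.comap ((TensorProduct.mk R (UniversalEnvelopingAlgebra R L) V).flip v))
      (one_tmul_mem v) fun x u hu => ι_smul_mem x (u ⊗ₜ v) hu
    exact (h ▸ Submodule.mem_top : u ∈ S.comap _)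

end EnvelopingAlgebra

namespace InducedModule

attribute [local instance 100] LieRing.ofAssociativeRing

open EnvelopingAlgebra

variable {R 𝔤 : Type*} [CommRing R] [LieRing 𝔤] [LieAlgebra R 𝔤]

section Embedding

variable (𝔥 : LieSubalgebra R 𝔤)
  (V : Type*) [AddCommGroup V] [Module R V] [LieRingModule 𝔥 V] [LieModule R 𝔥 V]

theorem envelopingMap_ι (y : 𝔥) :
    𝔥.envelopingMap (UniversalEnvelopingAlgebra.ι R y) =
      UniversalEnvelopingAlgebra.ι R (y : 𝔤) :=
  UniversalEnvelopingAlgebra.lift_ι_apply _ _ _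

theorem envelopingAction_ι (y : 𝔥) :
    LieModule.envelopingAction R 𝔥 V (UniversalEnvelopingAlgebra.ι R y) =
      LieModule.toEnd R 𝔥 V y :=
  UniversalEnvelopingAlgebra.lift_ι_apply _ _ _

/-- The canonical map `v ↦ 1 ⊗ v` from an `𝔥`-module `V` to the module induced by `V`. -/
noncomputable def of : V →ₗ[R] LieModule.Ind 𝔥 V :=
  ((LieModule.balancedRelations 𝔥 V).mkQ.restrictScalars R :
      UniversalEnvelopingAlgebra R 𝔤 ⊗[R] V →ₗ[R] LieModule.Ind 𝔥 V) ∘ₗ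
    TensorProduct.mk R (UniversalEnvelopingAlgebra R 𝔤) V 1

variable {V}

theorem lie_of (y : 𝔥) (v : V) : ⁅(y : 𝔤), of 𝔥 V v⁆ = of 𝔥 V ⁅y, v⁆ := by
  refine (Submodule.Quotient.eq (LieModule.balancedRelations 𝔥 V)).2 (Submodule.subset_span
    ⟨1, UniversalEnvelopingAlgebra.ι R y, v, ?_⟩)
  change UniversalEnvelopingAlgebra.ι R (y : 𝔤) • 1 ⊗ₜ[R] v - 1 ⊗ₜ[R] ⁅y, v⁆ = _
  rw [envelopingMap_ι, envelopingAction_ι, TensorProduct.smul_tmul', smul_eq_mul, mul_one,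
    one_mul, LieModule.toEnd_apply_apply]

variable (V) in
theorem lieSpan_range_of :
    LieSubmodule.lieSpan R 𝔤 (LinearMap.range (of 𝔥 V) : Set (LieModule.Ind 𝔥 V)) = ⊤ := by
  let W := LieSubmodule.lieSpan R 𝔤 (LinearMap.range (of 𝔥 V) : Set (LieModule.Ind 𝔥 V))
  let mk : UniversalEnvelopingAlgebra R 𝔤 ⊗[R] V →ₗ[R] LieModule.Ind 𝔥 V :=
    (LieModule.balancedRelations 𝔥 V).mkQ.restrictScalars R
  have h : W.toSubmodule.comap mk = ⊤ := tensor_eq_top_of_one_tmul_mem_of_ι_smul_mem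
    (fun v => LieSubmodule.subset_lieSpan ⟨v, rfl⟩) fun x t (ht : mk t ∈ W) => W.lie_mem (x := x) ht
  refine eq_top_iff.2 fun w _ => ?_
  obtain ⟨t, rfl⟩ := (LieModule.balancedRelations 𝔥 V).mkQ_surjective w
  exact (h ▸ Submodule.mem_top : t ∈ W.toSubmodule.comap mk)

end Embedding

section FrobeniusReciprocity

variable {𝔥 : LieSubalgebra R 𝔤} {V N : Type*} [AddCommGroup V] [Module R V] [LieRingModule 𝔥 V]
  [LieModule R 𝔥 V] [AddCommGroup N] [Module R N]
  {ρ : 𝔤 →ₗ⁅R⁆ Module.End R N} {φ : V →ₗ[R] N}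

theorem lift_envelopingMap_apply (hφ : ∀ (y : 𝔥) v, φ ⁅y, v⁆ = ρ y (φ v))
    (u : UniversalEnvelopingAlgebra R 𝔥) (v : V) :
    UniversalEnvelopingAlgebra.lift R ρ (𝔥.envelopingMap u) (φ v) =
      φ (LieModule.envelopingAction R 𝔥 V u v) := by
  let A := UniversalEnvelopingAlgebra.lift R ρ
  have h : LinearMap.eqLocus (φ.lcomp R N ∘ₗ A.toLinearMap ∘ₗ 𝔥.envelopingMap.toLinearMap)
      (LinearMap.compRight R φ ∘ₗ (LieModule.envelopingAction R 𝔥 V).toLinearMap) = ⊤ := by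
    refine eq_top_of_one_mem_of_ι_mul_mem ?_ fun y u hu => ?_
    · ext v
      simp
    · ext v
      have hu' : A (𝔥.envelopingMap u) (φ v) = φ (LieModule.envelopingAction R 𝔥 V u v) :=
        LinearMap.congr_fun hu v
      change A (𝔥.envelopingMap (UniversalEnvelopingAlgebra.ι R y * u)) (φ v) =
        φ (LieModule.envelopingAction R 𝔥 V (UniversalEnvelopingAlgebra.ι R y * u) v)
      rw [map_mul, map_mul, map_mul, envelopingMap_ι, envelopingAction_ι, Module.End.mul_apply,
        Module.End.mul_apply, hu', LieModule.toEnd_apply_apply, hφ,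
        UniversalEnvelopingAlgebra.lift_ι_apply]
  exact LinearMap.congr_fun (LinearMap.mem_eqLocus.1 (h ▸ Submodule.mem_top : u ∈ _)) v

theorem exists_extension (hφ : ∀ (y : 𝔥) v, φ ⁅y, v⁆ = ρ y (φ v)) :
    ∃ Φ : LieModule.Ind 𝔥 V →ₗ[R] N, ∀ v, Φ (of 𝔥 V v) = φ v := by
  let A := UniversalEnvelopingAlgebra.lift R ρ
  let B : UniversalEnvelopingAlgebra R 𝔤 ⊗[R] V →ₗ[R] N :=
    TensorProduct.lift (φ.lcomp R N ∘ₗ A.toLinearMap)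
  have B_tmul : ∀ u v, B (u ⊗ₜ v) = A u (φ v) := fun _ _ => rfl
  have B_smul : ∀ u t, B (u • t) = A u (B t) := by
    intro u t
    induction t with
    | zero => simp
    | add x y hx hy => rw [smul_add, map_add, map_add, map_add, hx, hy]
    | tmul u' v =>
      rw [TensorProduct.smul_tmul', smul_eq_mul, B_tmul, B_tmul, map_mul, Module.End.mul_apply]
  have B_eq_zero : (LieModule.balancedRelations 𝔥 V).restrictScalars R ≤ LinearMap.ker B := by
    intro t ht
    induction ht using Submodule.span_induction with
    | mem t ht =>
      obtain ⟨u, y, v, rfl⟩ := ht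
      rw [LinearMap.mem_ker, map_sub, B_tmul, B_tmul, map_mul, Module.End.mul_apply,
        lift_envelopingMap_apply hφ, sub_self]
    | zero => exact Submodule.zero_mem _
    | add x y _ _ hx hy => exact Submodule.add_mem _ hx hy
    | smul u x _ hx => rw [LinearMap.mem_ker, B_smul, LinearMap.mem_ker.1 hx, map_zero]
  refine ⟨((LieModule.balancedRelations 𝔥 V).restrictScalars R).liftQ B B_eq_zero, fun v => ?_⟩
  change A 1 (φ v) = φ v
  rw [map_one, Module.End.one_apply]

end FrobeniusReciprocity

section Curvature

variable {M : Type*} [AddCommGroup M] [Module R M] (a : 𝔤 →ₗ[R] Module.End R M)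

/-- The curvature `[a z, a z'] - a [z, z']` of a linear map `a : 𝔤 → End M`: the obstruction to
`a` being a representation. -/
noncomputable def curvature : 𝔤 →ₗ[R] 𝔤 →ₗ[R] Module.End R M :=
  LinearMap.mk₂ R (fun z z' => ⁅a z, a z'⁆ - a ⁅z, z'⁆)
    (fun _ _ _ => by simp only [map_add, add_lie]; abel)
    (fun _ _ _ => by simp only [map_smul, smul_lie, smul_sub])
    (fun _ _ _ => by simp only [map_add, lie_add]; abel)
    (fun _ _ _ => by simp only [map_smul, lie_smul, smul_sub])

theorem curvature_apply (z z' : 𝔤) : curvature a z z' = ⁅a z, a z'⁆ - a ⁅z, z'⁆ := rfl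

theorem curvature_swap (z z' : 𝔤) : curvature a z z' = -curvature a z' z := by
  rw [curvature_apply, curvature_apply, ← lie_skew, ← lie_skew z, map_neg]
  abel

variable {a}

theorem lie_curvature_of_curvature_eq_zero {x : 𝔤} (hx : curvature a x = 0) (z z' : 𝔤) :
    ⁅a x, curvature a z z'⁆ = curvature a ⁅x, z⁆ z' + curvature a z ⁅x, z'⁆ := by
  have map_lie : ∀ y, a ⁅x, y⁆ = ⁅a x, a y⁆ := fun y =>
    (sub_eq_zero.1 (LinearMap.congr_fun hx y)).symm
  simp only [curvature_apply, lie_sub, ← map_lie, leibniz_lie x z z', map_add,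
    leibniz_lie (a x) (a z) (a z')]
  abel

end Curvature

section Complement

variable {𝔥 𝔫 : LieSubalgebra R 𝔤}

/-- The projection of `𝔤` onto `𝔫` along a complementary subalgebra `𝔥`. -/
noncomputable def proj (hc : IsCompl 𝔫.toSubmodule 𝔥.toSubmodule) : 𝔤 →ₗ[R] 𝔫 :=
  𝔫.toSubmodule.projectionOnto 𝔥.toSubmodule hc

variable (hc : IsCompl 𝔫.toSubmodule 𝔥.toSubmodule)

theorem proj_coe_left (x : 𝔫) : proj hc x = x := Submodule.projectionOnto_apply_left hc x

theorem proj_coe_right (y : 𝔥) : proj hc y = 0 := Submodule.projectionOnto_apply_right hc y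

theorem proj_add_proj_symm (z : 𝔤) : (proj hc z : 𝔤) + proj hc.symm z = z :=
  Submodule.projection_add_projection_eq_self hc z

variable (𝔫) in
/-- The action of `𝔫` on the linear maps from `𝔤` to a free `𝔫`-module, where `𝔫` acts on `𝔤`
through the adjoint representation. -/
noncomputable def homAction (V : Type*) [AddCommGroup V] [Module R V] :
    𝔫 →ₗ⁅R⁆ Module.End R (𝔤 →ₗ[R] UniversalEnvelopingAlgebra R 𝔫 ⊗[R] V) where
  toFun x := LinearMap.compRight R (Algebra.lsmul R R _ (UniversalEnvelopingAlgebra.ι R x)) -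
    (LieAlgebra.ad R 𝔤 (x : 𝔤)).lcomp R _
  map_add' x y := by
    ext F z
    simp
    abel
  map_smul' r x := by
    ext F z
    simp [smul_sub]
  map_lie' {x y} := by
    ext F z
    simp [LieRing.of_associative_ring_bracket, smul_sub]
    abel

variable (V : Type*) [AddCommGroup V] [Module R V]

theorem homAction_apply (x : 𝔫) (F : 𝔤 →ₗ[R] UniversalEnvelopingAlgebra R 𝔫 ⊗[R] V) (z : 𝔤) :
    homAction 𝔫 V x F z = UniversalEnvelopingAlgebra.ι R x • F z - F ⁅(x : 𝔤), z⁆ := rfl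

variable [LieRingModule 𝔥 V] [LieModule R 𝔥 V]

/-- The restriction to `1 ⊗ V` of the action of `𝔤` on `U(𝔫) ⊗ V`, with the arguments swapped. -/
noncomputable def freeActionSeed : V →ₗ[R] 𝔤 →ₗ[R] UniversalEnvelopingAlgebra R 𝔫 ⊗[R] V :=
  LinearMap.mk₂ R
    (fun v z => UniversalEnvelopingAlgebra.ι R (proj hc z) ⊗ₜ[R] v + 1 ⊗ₜ[R] ⁅proj hc.symm z, v⁆)
    (fun _ _ _ => by simp only [lie_add, TensorProduct.tmul_add]; abel)
    (fun _ _ _ => by simp only [lie_smul, TensorProduct.tmul_smul, smul_add])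
    (fun _ _ _ => by
      simp only [map_add, add_lie, TensorProduct.tmul_add, TensorProduct.add_tmul]
      abel)
    (fun _ _ _ => by
      simp only [map_smul, smul_lie, TensorProduct.tmul_smul, smul_add,
        TensorProduct.smul_tmul'])

/-- The action of `𝔤` on `U(𝔫) ⊗ V` which makes it a model of the module induced by `V` when `𝔫`
is complementary to `𝔥`. It is determined by its values on `1 ⊗ V` and the rule
`z (x w) = x (z w) - [x, z] w` for `x ∈ 𝔫`. -/
noncomputable def freeAction : 𝔤 →ₗ[R] Module.End R (UniversalEnvelopingAlgebra R 𝔫 ⊗[R] V) :=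
  (TensorProduct.lift ((freeActionSeed hc V).lcomp R _ ∘ₗ
    (UniversalEnvelopingAlgebra.lift R (homAction 𝔫 V)).toLinearMap)).flip

variable {V}

theorem freeAction_one_tmul (z : 𝔤) (v : V) : freeAction hc V z (1 ⊗ₜ v) =
    UniversalEnvelopingAlgebra.ι R (proj hc z) ⊗ₜ[R] v + 1 ⊗ₜ[R] ⁅proj hc.symm z, v⁆ := by
  simp only [freeAction, LinearMap.flip_apply, TensorProduct.lift.tmul, LinearMap.comp_apply,
    AlgHom.toLinearMap_apply, map_one, LinearMap.lcomp_apply, Module.End.one_apply]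
  rfl

theorem freeAction_coe_one_tmul (y : 𝔥) (v : V) :
    freeAction hc V y (1 ⊗ₜ v) = 1 ⊗ₜ ⁅y, v⁆ := by
  rw [freeAction_one_tmul, proj_coe_right, proj_coe_left, map_zero, TensorProduct.zero_tmul,
    zero_add]

theorem freeAction_ι_smul (z : 𝔤) (x : 𝔫) (w : UniversalEnvelopingAlgebra R 𝔫 ⊗[R] V) :
    freeAction hc V z (UniversalEnvelopingAlgebra.ι R x • w) =
      UniversalEnvelopingAlgebra.ι R x • freeAction hc V z w - freeAction hc V ⁅(x : 𝔤), z⁆ w := by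
  induction w with
  | zero => simp only [smul_zero, map_zero, sub_zero]
  | add a b ha hb =>
    simp only [smul_add, map_add, ha, hb]
    abel
  | tmul u v =>
    simp only [TensorProduct.smul_tmul', smul_eq_mul, freeAction, LinearMap.flip_apply,
      TensorProduct.lift.tmul, LinearMap.comp_apply, AlgHom.toLinearMap_apply, map_mul,
      UniversalEnvelopingAlgebra.lift_ι_apply, LinearMap.lcomp_apply, Module.End.mul_apply,
      homAction_apply]

theorem freeAction_coe_apply (x : 𝔫) (w : UniversalEnvelopingAlgebra R 𝔫 ⊗[R] V) :
    freeAction hc V x w = UniversalEnvelopingAlgebra.ι R x • w := by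
  have h : ⨅ x : 𝔫, LinearMap.eqLocus (freeAction hc V x)
      (Algebra.lsmul R R _ (UniversalEnvelopingAlgebra.ι R x)) = ⊤ := by
    refine tensor_eq_top_of_one_tmul_mem_of_ι_smul_mem (fun v => ?_) fun y w hw => ?_ <;>
      simp only [Submodule.mem_iInf, LinearMap.mem_eqLocus, Algebra.lsmul_coe] at *
    · intro x
      rw [freeAction_one_tmul, proj_coe_left, proj_coe_right, zero_lie, TensorProduct.tmul_zero,
        add_zero, TensorProduct.smul_tmul', smul_eq_mul, mul_one]
    · intro x
      rw [freeAction_ι_smul, ← LieSubalgebra.coe_bracket, hw, hw, LieHom.map_lie,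
        LieRing.of_associative_ring_bracket, sub_smul, mul_smul, mul_smul, sub_sub_cancel]
  exact (Submodule.mem_iInf _).1 (h ▸ Submodule.mem_top : w ∈ _) x

theorem curvature_freeAction_coe_left (x : 𝔫) : curvature (freeAction hc V) x = 0 := by
  ext z : 1
  refine LinearMap.ext fun w => ?_
  rw [curvature_apply, LieRing.of_associative_ring_bracket]
  simp only [LinearMap.sub_apply, Module.End.mul_apply, freeAction_coe_apply, freeAction_ι_smul,
    sub_sub_cancel, sub_self, LinearMap.zero_apply]

theorem curvature_freeAction_eq_proj (z z' : 𝔤) : curvature (freeAction hc V) z z' =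
    curvature (freeAction hc V) (proj hc.symm z) (proj hc.symm z') := by
  have right : ∀ (z : 𝔤) (x : 𝔫), curvature (freeAction hc V) z x = 0 := fun z x => by
    rw [curvature_swap, curvature_freeAction_coe_left, LinearMap.zero_apply, neg_zero]
  conv_lhs => rw [← proj_add_proj_symm hc z, ← proj_add_proj_symm hc z']
  rw [map_add, right, zero_add, map_add, LinearMap.add_apply, curvature_freeAction_coe_left,
    LinearMap.zero_apply, zero_add]

theorem curvature_freeAction_one_tmul (y y' : 𝔥) (v : V) :
    curvature (freeAction hc V) y y' (1 ⊗ₜ v) = 0 := by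
  rw [curvature_apply, ← LieSubalgebra.coe_bracket, LieRing.of_associative_ring_bracket]
  simp only [LinearMap.sub_apply, Module.End.mul_apply, freeAction_coe_one_tmul, lie_lie,
    TensorProduct.tmul_sub, sub_self]

theorem curvature_freeAction : curvature (freeAction hc V) = 0 := by
  have h : ⨅ y : 𝔥, ⨅ y' : 𝔥, LinearMap.ker (curvature (freeAction hc V) y y') = ⊤ := by
    refine tensor_eq_top_of_one_tmul_mem_of_ι_smul_mem (fun v => ?_) fun x w hw => ?_ <;>
      simp only [Submodule.mem_iInf, LinearMap.mem_ker] at *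
    · exact fun y y' => curvature_freeAction_one_tmul hc y y' v
    · intro y y'
      have comm := LinearMap.congr_fun (lie_curvature_of_curvature_eq_zero
        (curvature_freeAction_coe_left hc x (V := V)) (y : 𝔤) y') w
      rw [LieRing.of_associative_ring_bracket, curvature_freeAction_eq_proj hc ⁅(x : 𝔤), (y : 𝔤)⁆,
        curvature_freeAction_eq_proj hc _ ⁅(x : 𝔤), (y' : 𝔤)⁆] at comm
      simpa only [LinearMap.sub_apply, LinearMap.add_apply, Module.End.mul_apply, hw, map_zero,
        zero_sub, add_zero, neg_eq_zero, freeAction_coe_apply] using comm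
  ext z z' : 2
  refine LinearMap.ext fun w => ?_
  rw [curvature_freeAction_eq_proj]
  have hw : w ∈ _ := h ▸ Submodule.mem_top
  simp only [Submodule.mem_iInf, LinearMap.mem_ker] at hw
  exact hw _ _

include hc in
theorem of_injective : Function.Injective (of 𝔥 V) := by
  let ρ : 𝔤 →ₗ⁅R⁆ Module.End R (UniversalEnvelopingAlgebra R 𝔫 ⊗[R] V) :=
    { freeAction hc V with
      map_lie' := fun {z z'} => (sub_eq_zero.1
        (LinearMap.congr_fun₂ (curvature_freeAction hc (V := V)) z z')).symm }
  obtain ⟨Φ, hΦ⟩ := exists_extension (ρ := ρ)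
    (φ := TensorProduct.mk R (UniversalEnvelopingAlgebra R 𝔫) V 1)
    fun y v => (freeAction_coe_one_tmul hc y v).symm
  let ε : UniversalEnvelopingAlgebra R 𝔫 →ₐ[R] R := UniversalEnvelopingAlgebra.lift R 0
  refine Function.LeftInverse.injective
    (g := (TensorProduct.lid R V).toLinearMap ∘ₗ ε.toLinearMap.rTensor V ∘ₗ Φ) fun v => ?_
  simp [hΦ]

end Complement

theorem isIrreducible_of_eq_bot_of_disjoint {𝔥 : LieSubalgebra R 𝔤} {V : Type*} [AddCommGroup V]
    [Module R V] [LieRingModule 𝔥 V] [LieModule R 𝔥 V] [LieModule.IsIrreducible R 𝔥 V]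
    (of_inj : Function.Injective (of 𝔥 V))
    (eq_bot : ∀ W : LieSubmodule R 𝔤 (LieModule.Ind 𝔥 V),
      Disjoint (LinearMap.range (of 𝔥 V)) W.toSubmodule → W = ⊥) :
    LieModule.IsIrreducible R 𝔤 (LieModule.Ind 𝔥 V) := by
  have := LieModule.nontrivial_of_isIrreducible R 𝔥 V
  have := of_inj.nontrivial
  refine LieModule.IsIrreducible.mk fun W hW => ?_
  let W' : LieSubmodule R 𝔥 V :=
    { W.toSubmodule.comap (of 𝔥 V) with
      lie_mem := fun {y v} hv => (lie_of 𝔥 y v ▸ W.lie_mem hv : of 𝔥 V ⁅y, v⁆ ∈ W) }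
  rcases eq_bot_or_eq_top W' with hbot | htop
  · refine absurd (eq_bot W (Submodule.disjoint_def.2 ?_)) hW
    rintro _ ⟨v, rfl⟩ hv
    rw [(LieSubmodule.eq_bot_iff W').1 hbot v hv, map_zero]
  · rw [eq_top_iff, ← lieSpan_range_of 𝔥 V, LieSubmodule.lieSpan_le]
    rintro _ ⟨v, rfl⟩
    exact (htop ▸ LieSubmodule.mem_top v : v ∈ W')

end InducedModule

section OperatorClosure

variable {R M : Type*} [CommRing R] [AddCommGroup M] [Module R M]

/-- The smallest subspace which contains `S` and is stable under the operators in `A`. -/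
def operatorClosure (A : Set (Module.End R M)) (S : Submodule R M) : Submodule R M :=
  sInf {N | S ≤ N ∧ ∀ a ∈ A, N ≤ N.comap a}

variable {A B : Set (Module.End R M)} {S T : Submodule R M}

theorem le_operatorClosure : S ≤ operatorClosure A S := le_sInf fun _ hN => hN.1

theorem apply_mem_operatorClosure {a : Module.End R M} (ha : a ∈ A) {m : M}
    (hm : m ∈ operatorClosure A S) : a m ∈ operatorClosure A S :=
  Submodule.mem_sInf.2 fun N hN => hN.2 a ha (Submodule.mem_sInf.1 hm N hN)

theorem operatorClosure_le (hS : S ≤ T)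
    (hA : ∀ a ∈ A, ∀ m ∈ operatorClosure A S, m ∈ T → a m ∈ T) : operatorClosure A S ≤ T :=
  have h : operatorClosure A S ⊓ T ∈ {N | S ≤ N ∧ ∀ a ∈ A, N ≤ N.comap a} :=
    ⟨le_inf le_operatorClosure hS, fun a ha m hm =>
      ⟨apply_mem_operatorClosure ha hm.1, hA a ha m hm.1 hm.2⟩⟩
  (sInf_le h).trans inf_le_right

theorem operatorClosure_mono (h : A ⊆ B) : operatorClosure A S ≤ operatorClosure B S :=
  operatorClosure_le le_operatorClosure fun _ ha _ _ => apply_mem_operatorClosure (h ha)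

theorem pow_apply_mem_operatorClosure_singleton {X : Module.End R M} {m : M} (hm : m ∈ S) (j : ℕ) :
    (X ^ j) m ∈ operatorClosure {X} S := by
  induction j with
  | zero => exact le_operatorClosure hm
  | succ j ih =>
    rw [pow_succ', Module.End.mul_apply]
    exact apply_mem_operatorClosure (Set.mem_singleton X) ih

theorem exists_eq_sum_of_mem_operatorClosure_singleton {X : Module.End R M} {m : M}
    (hm : m ∈ operatorClosure {X} S) :
    ∃ (n : ℕ) (t : ℕ → S), m = ∑ j ∈ Finset.range n, (X ^ j) (t j) := by
  let Ψ : (ℕ →₀ S) →ₗ[R] M := Finsupp.lsum R fun j => (X ^ j) ∘ₗ S.subtype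
  have Ψ_succ (f : ℕ →₀ S) : X (Ψ f) = Ψ (Finsupp.lmapDomain S R Nat.succ f) := by
    induction f using Finsupp.induction_linear with
    | zero => simp only [map_zero]
    | add f g hf hg => simp only [map_add, hf, hg]
    | single j s => simp [Ψ, Finsupp.mapDomain_single, pow_succ']
  have closure_le : operatorClosure {X} S ≤ LinearMap.range Ψ := by
    refine operatorClosure_le (fun s hs => ⟨Finsupp.single 0 ⟨s, hs⟩, by simp [Ψ]⟩) ?_
    rintro _ rfl _ _ ⟨f, rfl⟩
    exact ⟨_, (Ψ_succ f).symm⟩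
  obtain ⟨f, rfl⟩ := closure_le hm
  obtain ⟨n, hn⟩ := f.support.exists_nat_subset_range
  exact ⟨n, f, Finsupp.sum_of_support_subset _ hn _ fun _ _ => map_zero _⟩

end OperatorClosure

section OneVariable

variable {K M : Type*} [Field K] [AddCommGroup M] [Module K M]
  {X D E : Module.End K M} {T W : Submodule K M} {c : K}

variable (E_raise : ∀ m ∈ operatorClosure {X} T, E (X m) = X (E m))
  (lower_raise : ∀ m ∈ operatorClosure {X} T, D (X m) = X (D m) + c • E m)
  (lower_eq_zero : ∀ t ∈ T, D t = 0)

include E_raise lower_raise lower_eq_zero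

theorem lower_pow_succ_apply {t : M} (ht : t ∈ T) (j : ℕ) :
    D ((X ^ (j + 1)) t) = (X ^ j) (((j + 1) * c) • E t) := by
  have E_pow (j : ℕ) : E ((X ^ j) t) = (X ^ j) (E t) := by
    induction j with
    | zero => rfl
    | succ j ih =>
      rw [pow_succ', Module.End.mul_apply,
        E_raise _ (pow_apply_mem_operatorClosure_singleton ht j), ih, Module.End.mul_apply]
  induction j with
  | zero =>
    rw [zero_add, pow_one, pow_zero, lower_raise t (le_operatorClosure ht), lower_eq_zero t ht]
    simp
  | succ j ih =>
    rw [pow_succ', Module.End.mul_apply,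
      lower_raise _ (pow_apply_mem_operatorClosure_singleton ht (j + 1)), ih, E_pow,
      map_smul, map_smul, map_smul, ← Module.End.mul_apply X, ← pow_succ']
    push_cast
    module

theorem lower_sum_pow_apply (n : ℕ) (t : ℕ → T) :
    D (∑ j ∈ Finset.range (n + 1), (X ^ j) (t j : M)) =
      ∑ j ∈ Finset.range n, (X ^ j) (((j + 1) * c) • E (t (j + 1))) := by
  rw [Finset.sum_range_succ', map_add, map_sum, pow_zero, Module.End.one_apply,
    lower_eq_zero _ (t 0).2, add_zero]
  exact Finset.sum_congr rfl fun j _ =>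
    lower_pow_succ_apply E_raise lower_raise lower_eq_zero (t (j + 1)).2 j

variable [CharZero K] (hc : c ≠ 0) (E_mem : ∀ t ∈ T, E t ∈ T)
  (E_inj : Disjoint T (LinearMap.ker E))
  (lower_mem : ∀ w ∈ operatorClosure {X} T, w ∈ W → D w ∈ W) (hT : Disjoint T W)

include hc E_mem E_inj lower_mem hT

theorem coeff_eq_zero_of_sum_pow_mem {n : ℕ} {t : ℕ → T}
    (hW : ∑ j ∈ Finset.range n, (X ^ j) (t j : M) ∈ W) : ∀ j < n, t j = 0 := by
  induction n generalizing t with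
  | zero => exact fun j hj => absurd hj j.not_lt_zero
  | succ n ih =>
    have succ_eq_zero : ∀ j < n, t (j + 1) = 0 := fun j hj => by
      have lower_sum_mem := lower_mem _
        (sum_mem fun j _ => pow_apply_mem_operatorClosure_singleton (t j).2 j) hW
      rw [lower_sum_pow_apply E_raise lower_raise lower_eq_zero] at lower_sum_mem
      have h := ih (t := fun j => ⟨_, T.smul_mem ((j + 1) * c) (E_mem _ (t (j + 1)).2)⟩)
        lower_sum_mem j hj
      have hE := (smul_eq_zero.1 (congrArg Subtype.val h)).resolve_left
        (mul_ne_zero j.cast_add_one_ne_zero hc)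
      exact Subtype.ext (Submodule.disjoint_def.1 E_inj _ (t (j + 1)).2 hE)
    rw [Finset.sum_range_succ', Finset.sum_eq_zero fun j hj => by
      rw [succ_eq_zero j (Finset.mem_range.1 hj), ZeroMemClass.coe_zero, map_zero], zero_add]
      at hW
    rintro (_ | j) hj
    · exact Subtype.ext (Submodule.disjoint_def.1 hT _ (t 0).2 hW)
    · exact succ_eq_zero j (Nat.lt_of_succ_lt_succ hj)

theorem disjoint_operatorClosure_singleton : Disjoint (operatorClosure {X} T) W := by
  refine Submodule.disjoint_def.2 fun w hP hW => ?_
  obtain ⟨n, t, rfl⟩ := exists_eq_sum_of_mem_operatorClosure_singleton hP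
  exact Finset.sum_eq_zero fun j hj => by
    rw [coeff_eq_zero_of_sum_pow_mem E_raise lower_raise lower_eq_zero hc E_mem E_inj lower_mem
      hT hW j (Finset.mem_range.1 hj), ZeroMemClass.coe_zero, map_zero]

end OneVariable

section LoweringSystem

variable {K M : Type*} [Field K] [AddCommGroup M] [Module K M]

/-- Commuting operators `raise i`, applied to a subspace `S`, together with operators `lower p`
which kill `S` and lower the degree in `raise p`. The family is triangular: `lower p` commutes with
`raise i` for `i < p`, and nothing is required of its commutator with `raise i` for `p < i`. The
operator `E` replaces the scalar of the canonical commutation relations; it is injective on `S`. -/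
structure LoweringSystem (raise lower : ℕ → Module.End K M) (E : Module.End K M)
    (S : Submodule K M) : Prop where
  raise_raise : ∀ i j, ∀ m ∈ operatorClosure (Set.range raise) S,
    raise i (raise j m) = raise j (raise i m)
  E_raise : ∀ i, ∀ m ∈ operatorClosure (Set.range raise) S, E (raise i m) = raise i (E m)
  E_lower : ∀ p, ∀ m ∈ operatorClosure (Set.range raise) S, E (lower p m) = lower p (E m)
  lower_raise_of_lt : ∀ i p, i < p → ∀ m ∈ operatorClosure (Set.range raise) S,
    lower p (raise i m) = raise i (lower p m)
  lower_raise_self : ∀ p, ∃ c : K, c ≠ 0 ∧ ∀ m ∈ operatorClosure (Set.range raise) S,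
    lower p (raise p m) = raise p (lower p m) + c • E m
  lower_eq_zero : ∀ p, ∀ s ∈ S, lower p s = 0
  E_mem : ∀ s ∈ S, E s ∈ S
  E_inj : Disjoint S (LinearMap.ker E)

namespace LoweringSystem

variable {raise lower : ℕ → Module.End K M} {E : Module.End K M} {S W : Submodule K M}

/-- The part of the closure of `S` which involves only the operators `raise i` with `i < p`. -/
def stage (raise : ℕ → Module.End K M) (S : Submodule K M) (p : ℕ) : Submodule K M :=
  operatorClosure (raise '' Set.Iio p) S

theorem stage_le (p : ℕ) : stage raise S p ≤ operatorClosure (Set.range raise) S :=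
  operatorClosure_mono (Set.image_subset_range _ _)

theorem stage_zero : stage raise S 0 = S := by
  refine le_antisymm (operatorClosure_le le_rfl ?_) le_operatorClosure
  rintro _ ⟨i, hi, rfl⟩
  exact absurd hi (Nat.not_lt_zero i)

theorem raise_mem_stage {i p : ℕ} (h : i < p) {m : M} (hm : m ∈ stage raise S p) :
    raise i m ∈ stage raise S p :=
  apply_mem_operatorClosure (A := raise '' Set.Iio p) ⟨i, h, rfl⟩ hm

theorem stage_mono : Monotone (stage raise S) := fun _ _ h =>
  operatorClosure_mono (Set.image_mono (Set.Iio_subset_Iio h))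

theorem operatorClosure_range_eq_iSup_stage :
    operatorClosure (Set.range raise) S = ⨆ p, stage raise S p := by
  refine le_antisymm (operatorClosure_le ?_ ?_) (iSup_le stage_le)
  · exact stage_zero.ge.trans (le_iSup _ 0)
  · rintro _ ⟨i, rfl⟩ m - hm
    obtain ⟨p, hp⟩ := (Submodule.mem_iSup_of_directed _ stage_mono.directed_le).1 hm
    have h := stage_mono (le_max_left p (i + 1)) hp
    exact Submodule.mem_iSup_of_mem _ (raise_mem_stage (le_max_right p (i + 1)) h)

theorem stage_succ_le_range (p : ℕ) : operatorClosure {raise p} (stage raise S p) ≤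
    operatorClosure (Set.range raise) S :=
  operatorClosure_le (stage_le p) fun _ ha _ _ =>
    apply_mem_operatorClosure (A := Set.range raise) ⟨p, (Set.mem_singleton_iff.1 ha).symm⟩

variable (h : LoweringSystem raise lower E S)

include h

theorem stage_succ_le (p : ℕ) :
    stage raise S (p + 1) ≤ operatorClosure {raise p} (stage raise S p) := by
  refine operatorClosure_le (le_operatorClosure.trans le_operatorClosure) ?_
  rintro _ ⟨i, hi, rfl⟩ m - hm
  rcases Nat.lt_succ_iff_lt_or_eq.1 hi with hi | rfl
  · have raise_stable : operatorClosure {raise p} (stage raise S p) ≤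
        (operatorClosure {raise p} (stage raise S p)).comap (raise i) := by
      refine operatorClosure_le (fun m hm => le_operatorClosure (raise_mem_stage hi hm)) ?_
      rintro _ rfl m hm hm'
      rw [Submodule.mem_comap, h.raise_raise i p m (stage_succ_le_range p hm)]
      exact apply_mem_operatorClosure (Set.mem_singleton _) hm'
    exact raise_stable hm
  · exact apply_mem_operatorClosure (Set.mem_singleton _) hm

theorem lower_eq_zero_of_mem_stage {p : ℕ} {m : M} (hm : m ∈ stage raise S p) : lower p m = 0 := by
  have hle : stage raise S p ≤ LinearMap.ker (lower p) := by
    refine operatorClosure_le (h.lower_eq_zero p) ?_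
    rintro _ ⟨i, hi, rfl⟩ m hm hm'
    rw [LinearMap.mem_ker, h.lower_raise_of_lt i p hi m (stage_le p hm), LinearMap.mem_ker.1 hm',
      map_zero]
  exact hle hm

theorem E_mem_stage {p : ℕ} {m : M} (hm : m ∈ stage raise S p) : E m ∈ stage raise S p := by
  have hle : stage raise S p ≤ (stage raise S p).comap E := by
    refine operatorClosure_le (fun s hs => le_operatorClosure (h.E_mem s hs)) ?_
    rintro _ ⟨i, hi, rfl⟩ m hm hm'
    rw [Submodule.mem_comap, h.E_raise i m (stage_le p hm)]
    exact raise_mem_stage hi hm'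
  exact hle hm

variable [CharZero K]

theorem disjoint_stage_succ {p : ℕ} (E_inj : Disjoint (stage raise S p) (LinearMap.ker E))
    (lower_mem : ∀ w ∈ operatorClosure (Set.range raise) S, w ∈ W → lower p w ∈ W)
    (hp : Disjoint (stage raise S p) W) : Disjoint (stage raise S (p + 1)) W := by
  obtain ⟨c, hc, lower_raise⟩ := h.lower_raise_self p
  refine (disjoint_operatorClosure_singleton (fun m hm => h.E_raise p m (stage_succ_le_range p hm))
    (fun m hm => lower_raise m (stage_succ_le_range p hm))
    (fun _ => h.lower_eq_zero_of_mem_stage) hc (fun _ => h.E_mem_stage) E_inj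
    (fun w hw => lower_mem w (stage_succ_le_range p hw)) hp).mono_left (h.stage_succ_le p)

theorem disjoint_stage_ker (p : ℕ) : Disjoint (stage raise S p) (LinearMap.ker E) := by
  induction p with
  | zero => exact (stage_zero (raise := raise)).symm ▸ h.E_inj
  | succ p ih =>
    refine h.disjoint_stage_succ ih (fun w hw hE => ?_) ih
    rw [LinearMap.mem_ker, h.E_lower p w hw, LinearMap.mem_ker.1 hE, map_zero]

theorem disjoint_operatorClosure
    (lower_mem : ∀ p, ∀ w ∈ operatorClosure (Set.range raise) S, w ∈ W → lower p w ∈ W)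
    (hS : Disjoint S W) : Disjoint (operatorClosure (Set.range raise) S) W := by
  have disjoint_stage (p : ℕ) : Disjoint (stage raise S p) W := by
    induction p with
    | zero => exact (stage_zero (raise := raise)).symm ▸ hS
    | succ p ih => exact h.disjoint_stage_succ (h.disjoint_stage_ker p) (lower_mem p) ih
  rw [operatorClosure_range_eq_iSup_stage]
  exact stage_mono.directed_le.disjoint_iSup_left.2 disjoint_stage

theorem disjoint_operatorClosure_ker :
    Disjoint (operatorClosure (Set.range raise) S) (LinearMap.ker E) :=
  h.disjoint_operatorClosure
    (fun p w hw hE => by rw [LinearMap.mem_ker, h.E_lower p w hw, LinearMap.mem_ker.1 hE, map_zero])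
    h.E_inj

theorem mem_of_lower_eq_zero {m : M} (hm : m ∈ operatorClosure (Set.range raise) S)
    (lower_eq_zero : ∀ p, lower p m = 0) : m ∈ S := by
  by_contra hmS
  have hm0 : m ≠ 0 := fun h0 => hmS (h0 ▸ S.zero_mem)
  have hS : Disjoint S (K ∙ m) := (Submodule.disjoint_span_singleton' hm0).2 hmS
  have hd := h.disjoint_operatorClosure (W := K ∙ m) (fun p w _ hw => by
    obtain ⟨a, rfl⟩ := Submodule.mem_span_singleton.1 hw
    rw [map_smul, lower_eq_zero, smul_zero]
    exact Submodule.zero_mem _) hS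
  exact hmS (Submodule.disjoint_def.1 hd m hm (Submodule.mem_span_singleton_self m) ▸ S.zero_mem)

end LoweringSystem

end LoweringSystem

section FilteredLoweringSystem

variable {K M : Type*} [Field K] [AddCommGroup M] [Module K M]

/-- The subspace spanned by the products of fewer than `r` of the operators `raise i`, applied to
`S`. -/
def raiseFiltration (raise : ℕ → Module.End K M) (S : Submodule K M) : ℕ → Submodule K M
  | 0 => ⊥
  | r + 1 => S ⊔ ⨆ i, (raiseFiltration raise S r).map (raise i)

section Filtration

variable {raise : ℕ → Module.End K M} {S : Submodule K M}

theorem le_raiseFiltration_succ (r : ℕ) : S ≤ raiseFiltration raise S (r + 1) := le_sup_left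

theorem raise_mem_raiseFiltration (i : ℕ) {r : ℕ} {m : M} (hm : m ∈ raiseFiltration raise S r) :
    raise i m ∈ raiseFiltration raise S (r + 1) :=
  Submodule.mem_sup_right (Submodule.mem_iSup_of_mem i (Submodule.mem_map_of_mem hm))

theorem raiseFiltration_succ_le {T : Submodule K M} {r : ℕ} (hS : S ≤ T)
    (hraise : ∀ i, ∀ m ∈ raiseFiltration raise S r, raise i m ∈ T) :
    raiseFiltration raise S (r + 1) ≤ T :=
  sup_le hS (iSup_le fun i => Submodule.map_le_iff_le_comap.2 (hraise i))

theorem raiseFiltration_one_le : raiseFiltration raise S 1 ≤ S :=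
  raiseFiltration_succ_le le_rfl fun i m hm => by
    rw [(Submodule.mem_bot K).1 hm, map_zero]
    exact S.zero_mem

theorem raiseFiltration_mono : Monotone (raiseFiltration raise S) := by
  refine monotone_nat_of_le_succ fun r => ?_
  induction r with
  | zero => exact bot_le
  | succ r ih =>
    exact raiseFiltration_succ_le (le_raiseFiltration_succ _)
      fun i m hm => raise_mem_raiseFiltration i (ih hm)

theorem operatorClosure_range_le_iSup_raiseFiltration :
    operatorClosure (Set.range raise) S ≤ ⨆ r, raiseFiltration raise S r := by
  refine operatorClosure_le ((le_raiseFiltration_succ 0).trans (le_iSup _ 1)) ?_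
  rintro _ ⟨i, rfl⟩ m - hm
  obtain ⟨r, hr⟩ := (Submodule.mem_iSup_of_directed _ raiseFiltration_mono.directed_le).1 hm
  exact Submodule.mem_iSup_of_mem _ (raise_mem_raiseFiltration i hr)

end Filtration

/-- A family of operators which satisfies the relations of a `LoweringSystem` up to terms of lower
degree for the filtration `raiseFiltration`. -/
structure FilteredLoweringSystem (raise lower : ℕ → Module.End K M) (E : Module.End K M)
    (S : Submodule K M) : Prop where
  raise_raise : ∀ i j r, ∀ m ∈ raiseFiltration raise S r,
    raise i (raise j m) - raise j (raise i m) ∈ raiseFiltration raise S (r + 1)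
  E_raise : ∀ i r, ∀ m ∈ raiseFiltration raise S r,
    E (raise i m) - raise i (E m) ∈ raiseFiltration raise S r
  E_lower : ∀ p r, ∀ m ∈ raiseFiltration raise S (r + 2),
    E (lower p m) - lower p (E m) ∈ raiseFiltration raise S r
  lower_raise_of_lt : ∀ i p, i < p → ∀ r, ∀ m ∈ raiseFiltration raise S (r + 1),
    lower p (raise i m) - raise i (lower p m) ∈ raiseFiltration raise S r
  lower_raise_self : ∀ p, ∃ c : K, c ≠ 0 ∧ ∀ r, ∀ m ∈ raiseFiltration raise S (r + 1),
    lower p (raise p m) - (raise p (lower p m) + c • E m) ∈ raiseFiltration raise S r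
  lower_mem : ∀ p r, ∀ m ∈ raiseFiltration raise S (r + 1), lower p m ∈ raiseFiltration raise S r
  E_mem : ∀ r, ∀ m ∈ raiseFiltration raise S r, E m ∈ raiseFiltration raise S r
  E_inj : Disjoint S (LinearMap.ker E)

namespace FilteredLoweringSystem

variable {raise lower : ℕ → Module.End K M} {E : Module.End K M} {S W : Submodule K M}

variable (raise S) in
/-- The sequences whose `r`-th term vanishes in degree `r` of the graded space
`raiseFiltration (r + 1) / raiseFiltration r`. -/
def lowerOrder : Submodule K (ℕ → M) := Submodule.pi Set.univ (raiseFiltration raise S)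

variable (raise S) in
/-- A space which contains the associated graded space of `raiseFiltration`: it has
`M / raiseFiltration r` in degree `r`. -/
abbrev Graded : Type _ := (ℕ → M) ⧸ lowerOrder raise S

theorem graded_eq_iff {f g : ℕ → M} :
    (lowerOrder raise S).mkQ f = (lowerOrder raise S).mkQ g ↔
      ∀ r, f r - g r ∈ raiseFiltration raise S r := by
  rw [Submodule.mkQ_apply, Submodule.mkQ_apply, Submodule.Quotient.eq, lowerOrder]
  simp only [Submodule.mem_pi, Set.mem_univ, true_implies, Pi.sub_apply]

variable (raise S) in
/-- The operator of degree `1` on `Graded` induced by `raise i`. -/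
def gradedRaise (i : ℕ) : Module.End K (Graded raise S) :=
  (lowerOrder raise S).mapQ _
    (LinearMap.pi fun r => Nat.casesOn r 0 fun r => raise i ∘ₗ LinearMap.proj r)
    fun f hf r _ => by
      cases r with
      | zero => exact Submodule.zero_mem _
      | succ r => exact raise_mem_raiseFiltration i (hf r trivial)

variable (h : FilteredLoweringSystem raise lower E S)

/-- The operator of degree `-1` on `Graded` induced by `lower p`. -/
def gradedLower (p : ℕ) : Module.End K (Graded raise S) :=
  (lowerOrder raise S).mapQ _ (LinearMap.pi fun r => lower p ∘ₗ LinearMap.proj (r + 1))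
    fun _ hf r _ => h.lower_mem p r _ (hf (r + 1) trivial)

/-- The operator of degree `0` on `Graded` induced by `E`. -/
def gradedE : Module.End K (Graded raise S) :=
  (lowerOrder raise S).mapQ _ (LinearMap.pi fun r => E ∘ₗ LinearMap.proj r)
    fun _ hf r _ => h.E_mem r _ (hf r trivial)

variable (raise S) in
/-- The embedding of `S` in degree zero of `Graded`. -/
def gradedBase : Submodule K (Graded raise S) :=
  S.map ((lowerOrder raise S).mkQ ∘ₗ LinearMap.single K (fun _ => M) 0)

theorem exists_rep_of_mem_operatorClosure {q : Graded raise S}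
    (hq : q ∈ operatorClosure (Set.range (gradedRaise raise S)) (gradedBase raise S)) :
    ∃ f : ℕ → M, (∀ r, f r ∈ raiseFiltration raise S (r + 1)) ∧ (lowerOrder raise S).mkQ f = q := by
  have hle : operatorClosure (Set.range (gradedRaise raise S)) (gradedBase raise S) ≤
      (Submodule.pi Set.univ fun r => raiseFiltration raise S (r + 1)).map
        (lowerOrder raise S).mkQ := by
    refine operatorClosure_le (Submodule.map_le_iff_le_comap.2 fun s hs => ?_) ?_
    · refine Submodule.mem_map_of_mem (Submodule.mem_pi.2 fun r _ => ?_)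
      cases r with
      | zero => exact le_raiseFiltration_succ 0 hs
      | succ r => exact Submodule.zero_mem _
    · rintro _ ⟨i, rfl⟩ _ - ⟨f, hf, rfl⟩
      refine Submodule.mem_map_of_mem (f := (lowerOrder raise S).mkQ)
        (Submodule.mem_pi.2 fun r _ => ?_)
      cases r with
      | zero => exact Submodule.zero_mem _
      | succ r => exact raise_mem_raiseFiltration i (hf r trivial)
  obtain ⟨f, hf, rfl⟩ := hle hq
  exact ⟨f, fun r => hf r trivial, rfl⟩

theorem mk_single_eq_zero {r : ℕ} {m : M} (hm : m ∈ raiseFiltration raise S r) :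
    (lowerOrder raise S).mkQ (Pi.single r m) = 0 :=
  (graded_eq_iff (g := 0)).2 fun q => by
    obtain rfl | hq := eq_or_ne q r
    · simpa using hm
    · simp [hq]

theorem gradedRaise_mk_single (i r : ℕ) (m : M) :
    gradedRaise raise S i ((lowerOrder raise S).mkQ (Pi.single r m)) =
      (lowerOrder raise S).mkQ (Pi.single (r + 1) (raise i m)) :=
  graded_eq_iff.2 fun q => by
    cases q with
    | zero => simp
    | succ q => obtain rfl | hq := eq_or_ne q r <;> simp [*]

theorem mk_single_mem_operatorClosure {r : ℕ} {m : M} (hm : m ∈ raiseFiltration raise S (r + 1)) :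
    (lowerOrder raise S).mkQ (Pi.single r m) ∈
      operatorClosure (Set.range (gradedRaise raise S)) (gradedBase raise S) := by
  induction r generalizing m with
  | zero => exact le_operatorClosure ⟨m, raiseFiltration_one_le hm, rfl⟩
  | succ r ih =>
    have hle : raiseFiltration raise S (r + 2) ≤
        (operatorClosure (Set.range (gradedRaise raise S)) (gradedBase raise S)).comap
          ((lowerOrder raise S).mkQ ∘ₗ LinearMap.single K (fun _ => M) (r + 1)) := by
      refine raiseFiltration_succ_le (fun s hs => ?_) fun i m hm => ?_
      · change (lowerOrder raise S).mkQ (Pi.single (r + 1) s) ∈ operatorClosure _ _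
        rw [mk_single_eq_zero (le_raiseFiltration_succ r hs)]
        exact Submodule.zero_mem _
      · change (lowerOrder raise S).mkQ (Pi.single (r + 1) (raise i m)) ∈ operatorClosure _ _
        rw [← gradedRaise_mk_single]
        exact apply_mem_operatorClosure (Set.mem_range_self i) (ih hm)
    exact hle hm

include h in
theorem lower_eq_zero_of_mem_raiseFiltration_one {p : ℕ} {m : M}
    (hm : m ∈ raiseFiltration raise S 1) : lower p m = 0 :=
  (Submodule.mem_bot K).1 (h.lower_mem p 0 m hm)

theorem gradedLower_gradedRaise_of_lt {i p : ℕ} (hip : i < p) {q : Graded raise S}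
    (hq : q ∈ operatorClosure (Set.range (gradedRaise raise S)) (gradedBase raise S)) :
    h.gradedLower p (gradedRaise raise S i q) = gradedRaise raise S i (h.gradedLower p q) := by
  obtain ⟨f, hf, rfl⟩ := exists_rep_of_mem_operatorClosure hq
  refine graded_eq_iff.2 fun r => ?_
  have commutator_mem := h.lower_raise_of_lt i p hip r _ (hf r)
  cases r with
  | zero => rwa [h.lower_eq_zero_of_mem_raiseFiltration_one (hf 0), map_zero] at commutator_mem
  | succ _ => exact commutator_mem

theorem gradedLower_gradedRaise_self (p : ℕ) : ∃ c : K, c ≠ 0 ∧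
    ∀ q ∈ operatorClosure (Set.range (gradedRaise raise S)) (gradedBase raise S),
      h.gradedLower p (gradedRaise raise S p q) =
        gradedRaise raise S p (h.gradedLower p q) + c • h.gradedE q := by
  obtain ⟨c, hc, lower_raise⟩ := h.lower_raise_self p
  refine ⟨c, hc, fun q hq => ?_⟩
  obtain ⟨f, hf, rfl⟩ := exists_rep_of_mem_operatorClosure hq
  refine (graded_eq_iff (g := _ + c • _)).2 fun r => ?_
  have commutator_mem := lower_raise r _ (hf r)
  cases r with
  | zero => rwa [h.lower_eq_zero_of_mem_raiseFiltration_one (hf 0), map_zero] at commutator_mem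
  | succ _ => exact commutator_mem

theorem loweringSystem_graded :
    LoweringSystem (gradedRaise raise S) h.gradedLower h.gradedE (gradedBase raise S) where
  raise_raise i j q hq := by
    obtain ⟨f, hf, rfl⟩ := exists_rep_of_mem_operatorClosure hq
    refine graded_eq_iff.2 fun r => ?_
    match r with
    | 0 | 1 => simp
    | r + 2 => exact h.raise_raise i j _ _ (hf r)
  E_raise i q hq := by
    obtain ⟨f, hf, rfl⟩ := exists_rep_of_mem_operatorClosure hq
    refine graded_eq_iff.2 fun r => ?_
    cases r with
    | zero => simp
    | succ r => exact h.E_raise i _ _ (hf r)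
  E_lower p q hq := by
    obtain ⟨f, hf, rfl⟩ := exists_rep_of_mem_operatorClosure hq
    exact graded_eq_iff.2 fun r => h.E_lower p r _ (hf (r + 1))
  lower_raise_of_lt _ _ hip _ := h.gradedLower_gradedRaise_of_lt hip
  lower_raise_self := h.gradedLower_gradedRaise_self
  lower_eq_zero p := by
    rintro _ ⟨s, _, rfl⟩
    refine (graded_eq_iff (g := 0)).2 fun r => ?_
    simp
  E_mem := by
    rintro _ ⟨s, hs, rfl⟩
    refine ⟨E s, raiseFiltration_one_le (h.E_mem 1 s (le_raiseFiltration_succ 0 hs)), ?_⟩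
    refine graded_eq_iff.2 fun r => ?_
    cases r <;> simp
  E_inj := by
    rw [Submodule.disjoint_def]
    rintro _ ⟨s, hs, rfl⟩ hE
    have E_eq_zero := (graded_eq_iff (g := 0)).1 hE 0
    have s_eq_zero : s = 0 := Submodule.disjoint_def.1 h.E_inj s hs
      (by simpa [raiseFiltration] using E_eq_zero)
    rw [s_eq_zero, map_zero]

variable [CharZero K]

include h in
theorem mem_raiseFiltration_of_lower_mem {r : ℕ} {m : M}
    (hm : m ∈ raiseFiltration raise S (r + 2))
    (lower_mem : ∀ p, lower p m ∈ raiseFiltration raise S r) :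
    m ∈ raiseFiltration raise S (r + 1) := by
  obtain ⟨s, -, hs⟩ := h.loweringSystem_graded.mem_of_lower_eq_zero
    (mk_single_mem_operatorClosure hm) fun p => (graded_eq_iff (g := 0)).2 fun q => by
      obtain rfl | hq := eq_or_ne q r
      · simpa using lower_mem p
      · simp [hq]
  simpa using (graded_eq_iff.1 hs (r + 1))

include h in
theorem disjoint_operatorClosure (lower_mem : ∀ p, ∀ w ∈ W, lower p w ∈ W)
    (hS : Disjoint S W) : Disjoint (operatorClosure (Set.range raise) S) W := by
  refine .mono_left operatorClosure_range_le_iSup_raiseFiltration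
    (raiseFiltration_mono.directed_le.disjoint_iSup_left.2 fun r => ?_)
  induction r with
  | zero => exact disjoint_bot_left
  | succ r ih =>
    cases r with
    | zero => exact hS.mono_left raiseFiltration_one_le
    | succ r =>
      rw [Submodule.disjoint_def] at ih ⊢
      refine fun m hm hW => ih m (h.mem_raiseFiltration_of_lower_mem hm fun p => ?_) hW
      rw [ih _ (h.lower_mem p (r + 1) m hm) (lower_mem p m hW)]
      exact Submodule.zero_mem _

end FilteredLoweringSystem

end FilteredLoweringSystem

section LieOperatorClosure

variable {K 𝔤 M ι : Type*} [CommRing K] [LieRing 𝔤] [LieAlgebra K 𝔤] [AddCommGroup M] [Module K M]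
  [LieRingModule 𝔤 M] [LieModule K 𝔤 M] {x : ι → 𝔤} {S : Submodule K M}

theorem lie_lie_comm_of_lie_eq_zero {a b : 𝔤} (h : ⁅a, b⁆ = 0) (m : M) :
    ⁅a, ⁅b, m⁆⁆ = ⁅b, ⁅a, m⁆⁆ := by
  rw [leibniz_lie, h, zero_lie, zero_add]

theorem lie_mem_of_mem_span {A : Set 𝔤} {m : M} {T : Submodule K M} (hA : ∀ a ∈ A, ⁅a, m⁆ ∈ T)
    {a : 𝔤} (ha : a ∈ Submodule.span K A) : ⁅a, m⁆ ∈ T :=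
  Submodule.span_le (p := T.comap ((LieModule.toEnd K 𝔤 M : 𝔤 →ₗ[K] Module.End K M).flip m))
    |>.2 hA ha

theorem lie_mem_operatorClosure {A B : Set 𝔤} (lie_mem : ∀ a ∈ A, ∀ s ∈ S, ⁅a, s⁆ ∈ S)
    (subset : B ⊆ A ∪ Set.range x) (lie_x_mem : ∀ a ∈ A, ∀ i, ⁅a, x i⁆ ∈ Submodule.span K B)
    {m : M} (hm : m ∈ operatorClosure (Set.range fun i => LieModule.toEnd K 𝔤 M (x i)) S)
    {b : 𝔤} (hb : b ∈ Submodule.span K B) :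
    ⁅b, m⁆ ∈ operatorClosure (Set.range fun i => LieModule.toEnd K 𝔤 M (x i)) S := by
  set C := operatorClosure (Set.range fun i => LieModule.toEnd K 𝔤 M (x i)) S
  have lie_x_mem_C (i : ι) {m : M} (hm : m ∈ C) : ⁅x i, m⁆ ∈ C :=
    apply_mem_operatorClosure (Set.mem_range_self i) hm
  have lie_mem_C {m : M} (hm : m ∈ C) (hA : ∀ a ∈ A, ⁅a, m⁆ ∈ C) {b : 𝔤}
      (hb : b ∈ Submodule.span K B) : ⁅b, m⁆ ∈ C := by
    refine lie_mem_of_mem_span (fun b hb => ?_) hb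
    rcases subset hb with ha | ⟨i, rfl⟩
    · exact hA b ha
    · exact lie_x_mem_C i hm
  have C_le : C ≤ ⨅ a ∈ A, C.comap (LieModule.toEnd K 𝔤 M a) := by
    refine operatorClosure_le (le_iInf₂ fun a ha s hs => le_operatorClosure (lie_mem a ha s hs)) ?_
    rintro _ ⟨i, rfl⟩ m hm hA
    simp only [Submodule.mem_iInf] at hA ⊢
    intro a ha
    change ⁅a, ⁅x i, m⁆⁆ ∈ C
    rw [leibniz_lie]
    exact add_mem (lie_mem_C hm hA (lie_x_mem a ha i)) (lie_x_mem_C i (hA a ha))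
  have hA := C_le hm
  simp only [Submodule.mem_iInf] at hA
  exact lie_mem_C hm hA hb

theorem lie_eq_smul_of_mem_operatorClosure {a : 𝔤} {r : K} (lie_eq_smul : ∀ s ∈ S, ⁅a, s⁆ = r • s)
    (lie_x : ∀ i, ⁅a, x i⁆ = 0) {m : M}
    (hm : m ∈ operatorClosure (Set.range fun i => LieModule.toEnd K 𝔤 M (x i)) S) :
    ⁅a, m⁆ = r • m := by
  have hle : operatorClosure (Set.range fun i => LieModule.toEnd K 𝔤 M (x i)) S ≤
      LinearMap.eqLocus (LieModule.toEnd K 𝔤 M a) (r • LinearMap.id) := by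
    refine operatorClosure_le lie_eq_smul ?_
    rintro _ ⟨i, rfl⟩ m - (hm : ⁅a, m⁆ = r • m)
    change ⁅a, ⁅x i, m⁆⁆ = r • ⁅x i, m⁆
    rw [lie_lie_comm_of_lie_eq_zero (lie_x i), hm, lie_smul]
  exact hle hm

end LieOperatorClosure

namespace EHV

section Brackets

variable (α β : ℂ) (m n : ℤ)

theorem lie_L_L : ⁅L α β 0 m, L α β 0 n⁆ = ((m : ℂ) - n) • L α β 0 (m + n) +
    (if m + n = 0 then ((m : ℂ) ^ 3 - m) / 12 else 0) • C₁ α β 0 :=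
  lie_basis α β 0 (.L m) (.L n)

theorem lie_L_G : ⁅L α β 0 m, G α β 0 n⁆ = (-(α + n + m * β)) • G α β 0 (m + n) :=
  lie_basis α β 0 (.L m) (.G n)

theorem lie_G_L : ⁅G α β 0 n, L α β 0 m⁆ = (α + n + m * β) • G α β 0 (m + n) :=
  lie_basis α β 0 (.G n) (.L m)

theorem lie_J_J : ⁅J α β 0 m, J α β 0 n⁆ = (if m + n = 0 then (m : ℂ) else 0) • C₃ α β 0 :=
  lie_basis α β 0 (.J m) (.J n)

theorem lie_J_G : ⁅J α β 0 m, G α β 0 n⁆ = 0 :=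
  (lie_basis α β 0 (.J m) (.G n)).trans (zero_smul _ _)

theorem lie_G_J : ⁅G α β 0 n, J α β 0 m⁆ = 0 := by
  rw [← lie_skew, lie_J_G, neg_zero]

theorem lie_G_G : ⁅G α β 0 m, G α β 0 n⁆ = 0 := lie_basis α β 0 (.G m) (.G n)

theorem lie_C₃_J : ⁅C₃ α β 0, J α β 0 m⁆ = 0 := lie_basis α β 0 .C₃ (.J m)

theorem lie_C₃_G : ⁅C₃ α β 0, G α β 0 m⁆ = 0 := lie_basis α β 0 .C₃ (.G m)

end Brackets

section Complement

variable (α β : ℂ) (d₁ d₂ : ℕ)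

theorem basisBracket_mem_span_compl_parabolicIndex {a b : EHVIndex}
    (ha : a ∈ (parabolicIndex d₁ d₂)ᶜ) (hb : b ∈ (parabolicIndex d₁ d₂)ᶜ) :
    basisBracket α β 0 a b ∈ Submodule.span ℂ (basis α β 0 '' (parabolicIndex d₁ d₂)ᶜ) := by
  have smul_mem {c : EHVIndex} (hc : c ∈ (parabolicIndex d₁ d₂)ᶜ) (t : ℂ) : t • basis α β 0 c ∈
      Submodule.span ℂ (basis α β 0 '' (parabolicIndex d₁ d₂)ᶜ) :=
    Submodule.smul_mem _ t (Submodule.subset_span ⟨c, hc, rfl⟩)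
  rcases a with m | m | m | _ | _ | _ <;> rcases b with n | n | n | _ | _ | _ <;>
    simp only [parabolicIndex, Set.mem_compl_iff, Set.mem_ofPred_eq, not_le,
      not_true_eq_false] at ha hb
  all_goals
    simp only [basisBracket, neg_zero, zero_smul, Submodule.zero_mem]
    try rw [if_neg (by omega), zero_smul]
    try simp only [add_zero, sub_zero, Submodule.zero_mem]
  all_goals exact smul_mem (by
    simp only [parabolicIndex, Set.mem_compl_iff, Set.mem_ofPred_eq]; omega) _

/-- The subalgebra spanned by the basis vectors outside `parabolic α β d₁ d₂`. -/
noncomputable def oppositeParabolic : LieSubalgebra ℂ (EHV α β 0) where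
  toSubmodule := Submodule.span ℂ (basis α β 0 '' (parabolicIndex d₁ d₂)ᶜ)
  lie_mem' {x y} hx hy :=
    LinearMap.BilinMap.apply_apply_mem_of_mem_span _ _ _ (bracketMap α β 0) (by
      rintro _ ⟨a, ha, rfl⟩ _ ⟨b, hb, rfl⟩
      rw [bracketMap_basis]
      exact basisBracket_mem_span_compl_parabolicIndex α β d₁ d₂ ha hb) x y hx hy

theorem isCompl_oppositeParabolic : IsCompl (oppositeParabolic α β d₁ d₂).toSubmodule
    (parabolic α β d₁ d₂).toSubmodule := by
  constructor
  · exact (basis α β 0).linearIndependent.disjoint_span_image disjoint_compl_left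
  · rw [codisjoint_iff]
    change Submodule.span ℂ _ ⊔ Submodule.span ℂ _ = ⊤
    rw [← Submodule.span_union, ← Set.image_union, Set.compl_union_self, Set.image_univ,
      Module.Basis.span_eq]

end Complement

section Raising

variable (α β : ℂ) {M : Type*} [AddCommGroup M] [Module ℂ M] [LieRingModule (EHV α β 0) M]
  [LieModule ℂ (EHV α β 0) M]

variable (M) in
/-- The operators `G_n` with `n < -d`. -/
noncomputable abbrev raiseG (d i : ℕ) : Module.End ℂ M :=
  LieModule.toEnd ℂ (EHV α β 0) M (G α β 0 (-d - 1 - i))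

variable (M) in
/-- The operators `J_n` with `n < -d`. -/
noncomputable abbrev raiseJ (d i : ℕ) : Module.End ℂ M :=
  LieModule.toEnd ℂ (EHV α β 0) M (J α β 0 (-d - 1 - i))

variable (M) in
/-- The operators `L_n` with `n < 0`. -/
noncomputable abbrev raiseL (i : ℕ) : Module.End ℂ M :=
  LieModule.toEnd ℂ (EHV α β 0) M (L α β 0 (-1 - i))

variable (S : Submodule ℂ M)

/-- The smallest subspace which contains `S` and is stable under the `G_n` with `n < -d`. -/
abbrev closureG (d : ℕ) : Submodule ℂ M := operatorClosure (Set.range (raiseG α β M d)) S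

/-- The smallest subspace which contains `S` and is stable under the `J_n` with `n < -d`. -/
abbrev closureJ (d : ℕ) : Submodule ℂ M := operatorClosure (Set.range (raiseJ α β M d)) S

/-- The smallest subspace which contains `S` and is stable under the `L_n` with `n < 0`. -/
abbrev closureL : Submodule ℂ M := operatorClosure (Set.range (raiseL α β M)) S

/-- The labels of `L_i` (`i ≥ 0`), `J_{-d+i}` (`i ≥ 0`), all `G_m` and the central elements. -/
def parabolicIndexAddG (d : ℕ) : Set EHVIndex :=
  {a | match a with
    | .L m => 0 ≤ m
    | .J m => -(d : ℤ) ≤ m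
    | _ => True}

/-- The labels of `L_i` (`i ≥ 0`), all `J_m`, all `G_m` and the central elements. -/
def parabolicIndexAddGJ : Set EHVIndex :=
  {a | match a with
    | .L m => 0 ≤ m
    | _ => True}

theorem basis_image_parabolicIndexAddG_subset (d₁ d₂ : ℕ) :
    basis α β 0 '' parabolicIndexAddG d₂ ⊆
      basis α β 0 '' parabolicIndex d₁ d₂ ∪ Set.range fun i : ℕ => G α β 0 (-d₁ - 1 - i) := by
  rintro _ ⟨a, ha, rfl⟩
  rcases a with m | m | m | _ | _ | _
  case G =>
    rcases le_or_gt (-(d₁ : ℤ)) m with h | h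
    · exact Or.inl ⟨.G m, h, rfl⟩
    · exact Or.inr ⟨(-d₁ - 1 - m).toNat, congrArg (G α β 0) (by omega)⟩
  all_goals exact Or.inl (Set.mem_image_of_mem _ ha)

theorem basis_image_parabolicIndexAddGJ_subset (d : ℕ) :
    basis α β 0 '' parabolicIndexAddGJ ⊆
      basis α β 0 '' parabolicIndexAddG d ∪ Set.range fun i : ℕ => J α β 0 (-d - 1 - i) := by
  rintro _ ⟨a, ha, rfl⟩
  rcases a with m | m | m | _ | _ | _
  case J =>
    rcases le_or_gt (-(d : ℤ)) m with h | h
    · exact Or.inl ⟨.J m, h, rfl⟩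
    · exact Or.inr ⟨(-d - 1 - m).toNat, congrArg (J α β 0) (by omega)⟩
  all_goals exact Or.inl (Set.mem_image_of_mem _ ha)

theorem range_basis_subset :
    Set.range (basis α β 0) ⊆
      basis α β 0 '' parabolicIndexAddGJ ∪ Set.range fun i : ℕ => L α β 0 (-1 - i) := by
  rintro _ ⟨a, rfl⟩
  rcases a with m | m | m | _ | _ | _
  case L =>
    rcases le_or_gt 0 m with h | h
    · exact Or.inl ⟨.L m, h, rfl⟩
    · exact Or.inr ⟨(-1 - m).toNat, congrArg (L α β 0) (by omega)⟩
  all_goals exact Or.inl (Set.mem_image_of_mem _ trivial)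

variable {α β S}

theorem lie_mem_closureG {d₁ d₂ : ℕ} (lie_mem : ∀ y ∈ parabolic α β d₁ d₂, ∀ s ∈ S, ⁅y, s⁆ ∈ S)
    {m : M} (hm : m ∈ closureG α β S d₁) {z : EHV α β 0}
    (hz : z ∈ Submodule.span ℂ (basis α β 0 '' parabolicIndexAddG d₂)) :
    ⁅z, m⁆ ∈ closureG α β S d₁ := by
  refine lie_mem_operatorClosure (fun y hy => lie_mem y (Submodule.subset_span hy))
    (basis_image_parabolicIndexAddG_subset α β d₁ d₂) ?_ hm hz
  rintro _ ⟨a, -, rfl⟩ i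
  have smul_G_mem (n : ℤ) (t : ℂ) : t • G α β 0 n ∈
      Submodule.span ℂ (basis α β 0 '' parabolicIndexAddG d₂) :=
    Submodule.smul_mem _ t (Submodule.subset_span ⟨.G n, trivial, rfl⟩)
  change ⁅_, basis α β 0 (.G _)⁆ ∈ _
  rw [lie_basis]
  rcases a with _ | _ | _ | _ | _ | _ <;>
    first | exact smul_G_mem _ _ | exact Submodule.zero_mem _

theorem lie_mem_closureJ {d : ℕ}
    (lie_mem : ∀ a ∈ parabolicIndexAddG d, ∀ s ∈ S, ⁅basis α β 0 a, s⁆ ∈ S)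
    {m : M} (hm : m ∈ closureJ α β S d) {z : EHV α β 0}
    (hz : z ∈ Submodule.span ℂ (basis α β 0 '' parabolicIndexAddGJ)) :
    ⁅z, m⁆ ∈ closureJ α β S d := by
  refine lie_mem_operatorClosure (Set.forall_mem_image.2 lie_mem)
    (basis_image_parabolicIndexAddGJ_subset α β d) ?_ hm hz
  rintro _ ⟨a, -, rfl⟩ i
  have smul_mem {c : EHVIndex} (hc : c ∈ parabolicIndexAddGJ) (t : ℂ) : t • basis α β 0 c ∈
      Submodule.span ℂ (basis α β 0 '' parabolicIndexAddGJ) :=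
    Submodule.smul_mem _ t (Submodule.subset_span ⟨c, hc, rfl⟩)
  change ⁅_, basis α β 0 (.J _)⁆ ∈ _
  rw [lie_basis]
  rcases a with m | m | m | _ | _ | _ <;> simp only [basisBracket, Submodule.zero_mem]
  · exact sub_mem (smul_mem (c := .J _) trivial _) (smul_mem (c := .C₂) trivial _)
  · exact smul_mem (c := .C₃) trivial _
  · exact smul_mem (c := .G _) trivial _

theorem lie_mem_closureL
    (lie_mem : ∀ a ∈ parabolicIndexAddGJ, ∀ s ∈ S, ⁅basis α β 0 a, s⁆ ∈ S)
    {m : M} (hm : m ∈ closureL α β S) (z : EHV α β 0) : ⁅z, m⁆ ∈ closureL α β S :=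
  lie_mem_operatorClosure (Set.forall_mem_image.2 lie_mem) (range_basis_subset α β)
    (fun _ _ _ => (basis α β 0).mem_span _) hm ((basis α β 0).mem_span z)

end Raising

section Lowering

variable {α β : ℂ} {M : Type*} [AddCommGroup M] [Module ℂ M] [LieRingModule (EHV α β 0) M]
  [LieModule ℂ (EHV α β 0) M] {S : Submodule ℂ M}

theorem lie_G_eq_zero_of_mem_closureG {d : ℕ} {n : ℤ} (lie_G_eq_zero : ∀ s ∈ S, ⁅G α β 0 n, s⁆ = 0)
    {m : M} (hm : m ∈ closureG α β S d) : ⁅G α β 0 n, m⁆ = 0 := by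
  rw [lie_eq_smul_of_mem_operatorClosure (r := (0 : ℂ)) (by simpa using lie_G_eq_zero)
    (fun _ => lie_G_G α β _ _) hm, zero_smul]

theorem lie_J_eq_zero_of_mem_closureG {d : ℕ} {n : ℤ} (lie_J_eq_zero : ∀ s ∈ S, ⁅J α β 0 n, s⁆ = 0)
    {m : M} (hm : m ∈ closureG α β S d) : ⁅J α β 0 n, m⁆ = 0 := by
  rw [lie_eq_smul_of_mem_operatorClosure (r := (0 : ℂ)) (by simpa using lie_J_eq_zero)
    (fun _ => lie_J_G α β _ _) hm, zero_smul]

theorem lie_G_eq_zero_of_mem_closureJ {d : ℕ} {n : ℤ} (lie_G_eq_zero : ∀ s ∈ S, ⁅G α β 0 n, s⁆ = 0)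
    {m : M} (hm : m ∈ closureJ α β S d) : ⁅G α β 0 n, m⁆ = 0 := by
  rw [lie_eq_smul_of_mem_operatorClosure (r := (0 : ℂ)) (by simpa using lie_G_eq_zero)
    (fun _ => lie_G_J α β _ _) hm, zero_smul]

theorem loweringSystem_G (hαβ : ∀ m n : ℤ, m ≠ 0 → n ≠ 0 → α + (n : ℂ) + (m : ℂ) * β ≠ 0)
    {d k : ℕ} (lie_G_mem : ∀ s ∈ S, ⁅G α β 0 k, s⁆ ∈ S)
    (lie_G_inj : Disjoint S (LinearMap.ker (LieModule.toEnd ℂ (EHV α β 0) M (G α β 0 k))))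
    (lie_G_eq_zero : ∀ n : ℤ, k < n → ∀ s ∈ S, ⁅G α β 0 n, s⁆ = 0)
    (lie_L_eq_zero : ∀ n : ℤ, k + d < n → ∀ s ∈ S, ⁅L α β 0 n, s⁆ = 0) :
    LoweringSystem (raiseG α β M d)
      (fun p => LieModule.toEnd ℂ (EHV α β 0) M (L α β 0 (k + d + 1 + p)))
      (LieModule.toEnd ℂ (EHV α β 0) M (G α β 0 k)) S where
  raise_raise i j m _ := lie_lie_comm_of_lie_eq_zero (lie_G_G α β _ _) m
  E_raise i m _ := lie_lie_comm_of_lie_eq_zero (lie_G_G α β _ _) m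
  E_lower p m hm := by
    change ⁅_, ⁅_, m⁆⁆ = ⁅_, ⁅_, m⁆⁆
    rw [leibniz_lie, lie_G_L, smul_lie,
      lie_G_eq_zero_of_mem_closureG (lie_G_eq_zero _ (by omega)) hm, smul_zero, zero_add]
  lower_raise_of_lt i p hip m hm := by
    change ⁅_, ⁅_, m⁆⁆ = ⁅_, ⁅_, m⁆⁆
    rw [leibniz_lie, lie_L_G, smul_lie,
      lie_G_eq_zero_of_mem_closureG (lie_G_eq_zero _ (by omega)) hm, smul_zero, zero_add]
  lower_raise_self p := by
    refine ⟨-(α + (-d - 1 - p : ℤ) + (k + d + 1 + p : ℤ) * β),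
      neg_ne_zero.2 (hαβ _ _ (by omega) (by omega)), fun m _ => ?_⟩
    change ⁅_, ⁅_, m⁆⁆ = ⁅_, ⁅_, m⁆⁆ + _ • ⁅_, m⁆
    rw [leibniz_lie, lie_L_G, smul_lie, add_comm]
    congr! 5
    ring
  lower_eq_zero p := lie_L_eq_zero _ (by omega)
  E_mem := lie_G_mem
  E_inj := lie_G_inj

theorem loweringSystem_J {d : ℕ} {ℓ : ℂ} (hℓ : ℓ ≠ 0) (lie_C₃ : ∀ s ∈ S, ⁅C₃ α β 0, s⁆ = ℓ • s)
    (lie_J_eq_zero : ∀ n : ℤ, d < n → ∀ s ∈ S, ⁅J α β 0 n, s⁆ = 0) :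
    LoweringSystem (raiseJ α β M d)
      (fun p => LieModule.toEnd ℂ (EHV α β 0) M (J α β 0 (d + 1 + p)))
      (LieModule.toEnd ℂ (EHV α β 0) M (C₃ α β 0)) S where
  raise_raise i j m _ := lie_lie_comm_of_lie_eq_zero
    (by rw [lie_J_J, if_neg (by omega), zero_smul]) m
  E_raise i m _ := lie_lie_comm_of_lie_eq_zero (lie_C₃_J α β _) m
  E_lower p m _ := lie_lie_comm_of_lie_eq_zero (lie_C₃_J α β _) m
  lower_raise_of_lt i p hip m _ := lie_lie_comm_of_lie_eq_zero
    (by rw [lie_J_J, if_neg (by omega), zero_smul]) m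
  lower_raise_self p := by
    refine ⟨(d + 1 + p : ℤ), Int.cast_ne_zero.2 (by omega), fun m _ => ?_⟩
    change ⁅_, ⁅_, m⁆⁆ = ⁅_, ⁅_, m⁆⁆ + _ • ⁅_, m⁆
    rw [leibniz_lie, lie_J_J, if_pos (by omega), smul_lie, add_comm]
  lower_eq_zero p := lie_J_eq_zero _ (by omega)
  E_mem s hs := by
    rw [LieModule.toEnd_apply_apply, lie_C₃ s hs]
    exact S.smul_mem ℓ hs
  E_inj := Submodule.disjoint_def.2 fun s hs h =>
    (smul_eq_zero.1 ((lie_C₃ s hs).symm.trans h)).resolve_left hℓ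

theorem lie_G_mem_raiseFiltration (lie_G_mem : ∀ n, ∀ s ∈ S, ⁅G α β 0 n, s⁆ ∈ S) (n : ℤ) {r : ℕ}
    {m : M} (hm : m ∈ raiseFiltration (raiseL α β M) S r) :
    ⁅G α β 0 n, m⁆ ∈ raiseFiltration (raiseL α β M) S r := by
  have hle : raiseFiltration (raiseL α β M) S r ≤ (raiseFiltration (raiseL α β M) S r).comap
      (LieModule.toEnd ℂ (EHV α β 0) M (G α β 0 n)) := by
    induction r generalizing n m with
    | zero => exact bot_le
    | succ r ih =>
      refine raiseFiltration_succ_le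
        (fun s hs => le_raiseFiltration_succ r (lie_G_mem n s hs)) fun i m hm => ?_
      change ⁅G α β 0 n, ⁅L α β 0 (-1 - i), m⁆⁆ ∈ raiseFiltration (raiseL α β M) S (r + 1)
      rw [leibniz_lie, lie_G_L, smul_lie]
      exact add_mem (Submodule.smul_mem _ _ (raiseFiltration_mono r.le_succ (ih _ hm hm)))
        (raise_mem_raiseFiltration i (ih n hm hm))
  exact hle hm

theorem lie_G_mem_raiseFiltration_of_lt {k : ℤ} (lie_G_mem : ∀ n, ∀ s ∈ S, ⁅G α β 0 n, s⁆ ∈ S)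
    (lie_G_eq_zero : ∀ n, k < n → ∀ s ∈ S, ⁅G α β 0 n, s⁆ = 0) {n : ℤ} (hn : k < n) {r : ℕ}
    {m : M} (hm : m ∈ raiseFiltration (raiseL α β M) S (r + 1)) :
    ⁅G α β 0 n, m⁆ ∈ raiseFiltration (raiseL α β M) S r := by
  have hle : raiseFiltration (raiseL α β M) S (r + 1) ≤ (raiseFiltration (raiseL α β M) S r).comap
      (LieModule.toEnd ℂ (EHV α β 0) M (G α β 0 n)) := by
    induction r generalizing m with
    | zero => exact fun m hm => lie_G_eq_zero n hn m (raiseFiltration_one_le hm)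
    | succ r ih =>
      refine raiseFiltration_succ_le (fun s hs => ?_) fun i m hm => ?_
      · rw [Submodule.mem_comap, LieModule.toEnd_apply_apply, lie_G_eq_zero n hn s hs]
        exact Submodule.zero_mem _
      · change ⁅G α β 0 n, ⁅L α β 0 (-1 - i), m⁆⁆ ∈ raiseFiltration (raiseL α β M) S (r + 1)
        rw [leibniz_lie, lie_G_L, smul_lie]
        exact add_mem (Submodule.smul_mem _ _ (lie_G_mem_raiseFiltration lie_G_mem _ hm))
          (raise_mem_raiseFiltration i (ih hm hm))
  exact hle hm

theorem filteredLoweringSystem_L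
    (hαβ : ∀ m n : ℤ, m ≠ 0 → n ≠ 0 → α + (n : ℂ) + (m : ℂ) * β ≠ 0)
    {k : ℕ} (lie_G_mem : ∀ n, ∀ s ∈ S, ⁅G α β 0 n, s⁆ ∈ S)
    (lie_G_inj : Disjoint S (LinearMap.ker (LieModule.toEnd ℂ (EHV α β 0) M (G α β 0 k))))
    (lie_G_eq_zero : ∀ n : ℤ, k < n → ∀ s ∈ S, ⁅G α β 0 n, s⁆ = 0) :
    FilteredLoweringSystem (raiseL α β M)
      (fun p => LieModule.toEnd ℂ (EHV α β 0) M (G α β 0 (k + 1 + p)))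
      (LieModule.toEnd ℂ (EHV α β 0) M (G α β 0 k)) S where
  raise_raise i j r m hm := by
    change ⁅_, ⁅_, m⁆⁆ - ⁅_, ⁅_, m⁆⁆ ∈ _
    rw [leibniz_lie, add_sub_cancel_right, lie_L_L, if_neg (by omega), zero_smul, add_zero,
      smul_lie, show (-1 - i + (-1 - j) : ℤ) = -1 - (i + j + 1 : ℕ) by push_cast; ring]
    exact Submodule.smul_mem _ _ (raise_mem_raiseFiltration (i + j + 1) hm)
  E_raise i r m hm := by
    change ⁅_, ⁅_, m⁆⁆ - ⁅_, ⁅_, m⁆⁆ ∈ _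
    rw [leibniz_lie, add_sub_cancel_right, lie_G_L, smul_lie]
    exact Submodule.smul_mem _ _ (lie_G_mem_raiseFiltration lie_G_mem _ hm)
  E_lower p r m _ := sub_eq_zero.2 (lie_lie_comm_of_lie_eq_zero (lie_G_G α β _ _) m) ▸
    Submodule.zero_mem _
  lower_raise_of_lt i p hip r m hm := by
    change ⁅_, ⁅_, m⁆⁆ - ⁅_, ⁅_, m⁆⁆ ∈ _
    rw [leibniz_lie, add_sub_cancel_right, lie_G_L, smul_lie]
    exact Submodule.smul_mem _ _
      (lie_G_mem_raiseFiltration_of_lt lie_G_mem lie_G_eq_zero (by omega) hm)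
  lower_raise_self p := by
    refine ⟨α + (k + 1 + p : ℤ) + (-1 - p : ℤ) * β, hαβ _ _ (by omega) (by omega),
      fun r m _ => ?_⟩
    change ⁅_, ⁅_, m⁆⁆ - (⁅_, ⁅_, m⁆⁆ + _ • ⁅_, m⁆) ∈ _
    rw [leibniz_lie, lie_G_L, smul_lie, show (-1 - p + (k + 1 + p) : ℤ) = k by ring, add_comm,
      sub_self]
    exact Submodule.zero_mem _
  lower_mem p r m := lie_G_mem_raiseFiltration_of_lt lie_G_mem lie_G_eq_zero (by omega)
  E_mem r m := lie_G_mem_raiseFiltration lie_G_mem k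
  E_inj := lie_G_inj

end Lowering

section Simplicity

variable {α β : ℂ} {M : Type*} [AddCommGroup M] [Module ℂ M] [LieRingModule (EHV α β 0) M]
  [LieModule ℂ (EHV α β 0) M] {S : Submodule ℂ M} {d₁ d₂ : ℕ}

section Stability

variable (lie_mem : ∀ y ∈ parabolic α β d₁ d₂, ∀ s ∈ S, ⁅y, s⁆ ∈ S)

include lie_mem

theorem lie_basis_mem_closureJ_closureG {a : EHVIndex} (ha : a ∈ parabolicIndexAddGJ) {m : M}
    (hm : m ∈ closureJ α β (closureG α β S d₁) d₂) :
    ⁅basis α β 0 a, m⁆ ∈ closureJ α β (closureG α β S d₁) d₂ :=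
  lie_mem_closureJ
    (fun _ hb _ hs => lie_mem_closureG lie_mem hs (Submodule.subset_span ⟨_, hb, rfl⟩)) hm
    (Submodule.subset_span ⟨a, ha, rfl⟩)

theorem lie_mem_closureL_closureJ_closureG {m : M}
    (hm : m ∈ closureL α β (closureJ α β (closureG α β S d₁) d₂)) (z : EHV α β 0) :
    ⁅z, m⁆ ∈ closureL α β (closureJ α β (closureG α β S d₁) d₂) :=
  lie_mem_closureL (fun _ ha _ => lie_basis_mem_closureJ_closureG lie_mem ha) hm z

end Stability

theorem disjoint_closureJ_ker {ℓ : ℂ} (hℓ : ℓ ≠ 0) (lie_C₃ : ∀ s ∈ S, ⁅C₃ α β 0, s⁆ = ℓ • s)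
    (lie_J_eq_zero : ∀ n : ℤ, d₂ < n → ∀ s ∈ S, ⁅J α β 0 n, s⁆ = 0) {n : ℤ}
    (lie_G_inj : Disjoint S (LinearMap.ker (LieModule.toEnd ℂ (EHV α β 0) M (G α β 0 n)))) :
    Disjoint (closureJ α β S d₂) (LinearMap.ker (LieModule.toEnd ℂ (EHV α β 0) M (G α β 0 n))) :=
  (loweringSystem_J hℓ lie_C₃ lie_J_eq_zero).disjoint_operatorClosure
    (fun _ w _ (hw : ⁅G α β 0 n, w⁆ = 0) =>
      (lie_lie_comm_of_lie_eq_zero (lie_G_J α β _ _) w).trans ((congrArg _ hw).trans (lie_zero _)))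
    lie_G_inj

theorem disjoint_closureL_closureJ_closureG
    (hαβ : ∀ m n : ℤ, m ≠ 0 → n ≠ 0 → α + (n : ℂ) + (m : ℂ) * β ≠ 0)
    (lie_mem : ∀ y ∈ parabolic α β d₁ d₂, ∀ s ∈ S, ⁅y, s⁆ ∈ S) {ℓ : ℂ} (hℓ : ℓ ≠ 0)
    (lie_C₃ : ∀ s ∈ S, ⁅C₃ α β 0, s⁆ = ℓ • s) {k : ℕ}
    (lie_G_inj : Disjoint S (LinearMap.ker (LieModule.toEnd ℂ (EHV α β 0) M (G α β 0 k))))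
    (lie_G_eq_zero : ∀ n : ℤ, k < n → ∀ s ∈ S, ⁅G α β 0 n, s⁆ = 0)
    (lie_J_eq_zero : ∀ n : ℤ, d₂ < n → ∀ s ∈ S, ⁅J α β 0 n, s⁆ = 0)
    (lie_L_eq_zero : ∀ n : ℤ, k + d₁ < n → ∀ s ∈ S, ⁅L α β 0 n, s⁆ = 0)
    {W : LieSubmodule ℂ (EHV α β 0) M} (hS : Disjoint S W.toSubmodule) :
    Disjoint (closureL α β (closureJ α β (closureG α β S d₁) d₂)) W.toSubmodule := by
  have systemG : LoweringSystem _ _ _ S := loweringSystem_G hαβ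
    (lie_mem _ (G_mem_parabolic (by omega))) lie_G_inj lie_G_eq_zero lie_L_eq_zero
  have lie_C₃_closureG : ∀ m ∈ closureG α β S d₁, ⁅C₃ α β 0, m⁆ = ℓ • m := fun m =>
    lie_eq_smul_of_mem_operatorClosure lie_C₃ fun _ => lie_C₃_G α β _
  have lie_J_closureG : ∀ n : ℤ, d₂ < n → ∀ m ∈ closureG α β S d₁, ⁅J α β 0 n, m⁆ = 0 :=
    fun n hn m => lie_J_eq_zero_of_mem_closureG (lie_J_eq_zero n hn)
  have systemL := filteredLoweringSystem_L hαβ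
    (fun n _ => lie_basis_mem_closureJ_closureG lie_mem (a := .G n) trivial)
    (disjoint_closureJ_ker hℓ lie_C₃_closureG lie_J_closureG systemG.disjoint_operatorClosure_ker)
    fun n hn _ => lie_G_eq_zero_of_mem_closureJ fun _ =>
      lie_G_eq_zero_of_mem_closureG (lie_G_eq_zero n hn)
  refine systemL.disjoint_operatorClosure (fun _ _ => W.lie_mem) ?_
  refine (loweringSystem_J hℓ lie_C₃_closureG lie_J_closureG).disjoint_operatorClosure
    (fun _ _ _ => W.lie_mem) ?_
  exact systemG.disjoint_operatorClosure (fun _ _ _ => W.lie_mem) hS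

theorem eq_bot_of_disjoint
    (hαβ : ∀ m n : ℤ, m ≠ 0 → n ≠ 0 → α + (n : ℂ) + (m : ℂ) * β ≠ 0)
    (lieSpan_eq_top : LieSubmodule.lieSpan ℂ (EHV α β 0) (S : Set M) = ⊤)
    (lie_mem : ∀ y ∈ parabolic α β d₁ d₂, ∀ s ∈ S, ⁅y, s⁆ ∈ S) {ℓ : ℂ} (hℓ : ℓ ≠ 0)
    (lie_C₃ : ∀ s ∈ S, ⁅C₃ α β 0, s⁆ = ℓ • s) {k : ℕ}
    (lie_G_inj : Disjoint S (LinearMap.ker (LieModule.toEnd ℂ (EHV α β 0) M (G α β 0 k))))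
    (lie_G_eq_zero : ∀ i : ℕ, 1 ≤ i → ∀ s ∈ S, ⁅G α β 0 (k + i), s⁆ = 0)
    (lie_J_eq_zero : ∀ i : ℕ, 1 ≤ i → ∀ s ∈ S, ⁅J α β 0 (d₂ + i), s⁆ = 0)
    (lie_L_eq_zero : ∀ i : ℕ, 1 ≤ i → ∀ s ∈ S, ⁅L α β 0 (k + d₁ + i), s⁆ = 0)
    {W : LieSubmodule ℂ (EHV α β 0) M} (hS : Disjoint S W.toSubmodule) : W = ⊥ := by
  let C : LieSubmodule ℂ (EHV α β 0) M :=
    { closureL α β (closureJ α β (closureG α β S d₁) d₂) with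
      lie_mem := fun hm => lie_mem_closureL_closureJ_closureG lie_mem hm _ }
  have hC : C = ⊤ := by
    rw [eq_top_iff, ← lieSpan_eq_top, LieSubmodule.lieSpan_le]
    exact le_operatorClosure.trans (le_operatorClosure.trans le_operatorClosure)
  have forall_lt {a : ℤ} {P : ℤ → Prop} (h : ∀ i : ℕ, 1 ≤ i → P (a + i)) (n : ℤ) (hn : a < n) :
      P n := by
    obtain ⟨i, rfl⟩ := Int.le.dest hn.le
    exact h i (by omega)
  have disjoint : Disjoint C.toSubmodule W.toSubmodule :=
    disjoint_closureL_closureJ_closureG hαβ lie_mem hℓ lie_C₃ lie_G_inj (forall_lt lie_G_eq_zero)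
      (forall_lt lie_J_eq_zero) (forall_lt lie_L_eq_zero) hS
  rwa [hC, LieSubmodule.top_toSubmodule, top_disjoint, LieSubmodule.toSubmodule_eq_bot] at disjoint

end Simplicity

end EHV

theorem mainTheorem4 (α β : ℂ)
    (hαβ : ∀ m n : ℤ, m ≠ 0 → n ≠ 0 → α + (n : ℂ) + (m : ℂ) * β ≠ 0)
    (d₁ d₂ : ℕ) (V : Type*) [AddCommGroup V] [Module ℂ V]
    [LieRingModule (EHV.parabolic α β d₁ d₂) V] [LieModule ℂ (EHV.parabolic α β d₁ d₂) V]
    (hV : LieModule.IsIrreducible ℂ (EHV.parabolic α β d₁ d₂) V)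
    (ℓ₃ : ℂ) (hℓ₃ : ℓ₃ ≠ 0)
    (hC₃ : ∀ v : V,
      ⁅(⟨EHV.C₃ α β 0, EHV.C₃_mem_parabolic⟩ : EHV.parabolic α β d₁ d₂), v⁆ = ℓ₃ • v)
    (k : ℕ)
    (hGinj : Function.Injective fun v : V =>
      ⁅(⟨EHV.G α β 0 k, EHV.G_mem_parabolic (by omega)⟩ : EHV.parabolic α β d₁ d₂), v⁆)
    (hG : ∀ i : ℕ, 1 ≤ i → ∀ v : V,
      ⁅(⟨EHV.G α β 0 (k + i), EHV.G_mem_parabolic (by omega)⟩ :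
        EHV.parabolic α β d₁ d₂), v⁆ = 0)
    (hJ : ∀ i : ℕ, 1 ≤ i → ∀ v : V,
      ⁅(⟨EHV.J α β 0 (d₂ + i), EHV.J_mem_parabolic (by omega)⟩ :
        EHV.parabolic α β d₁ d₂), v⁆ = 0)
    (hL : ∀ i : ℕ, 1 ≤ i → ∀ v : V,
      ⁅(⟨EHV.L α β 0 (k + d₁ + i), EHV.L_mem_parabolic (by omega)⟩ :
        EHV.parabolic α β d₁ d₂), v⁆ = 0) :
    LieModule.IsIrreducible ℂ (EHV α β 0) (LieModule.Ind (EHV.parabolic α β d₁ d₂) V) := by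
  have of_inj : Function.Injective (InducedModule.of (EHV.parabolic α β d₁ d₂) V) :=
    InducedModule.of_injective (EHV.isCompl_oppositeParabolic α β d₁ d₂)
  have lie_of {x} (hx : x ∈ EHV.parabolic α β d₁ d₂) (v : V) :
      ⁅x, InducedModule.of _ V v⁆ = InducedModule.of _ V ⁅(⟨x, hx⟩ : EHV.parabolic α β d₁ d₂), v⁆ :=
    InducedModule.lie_of _ ⟨x, hx⟩ v
  refine InducedModule.isIrreducible_of_eq_bot_of_disjoint of_inj fun W =>
    EHV.eq_bot_of_disjoint hαβ (InducedModule.lieSpan_range_of _ V) (d₁ := d₁) (d₂ := d₂) (k := k)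
      ?lie_mem hℓ₃ ?lie_C₃ (Submodule.disjoint_def.2 ?lie_G_inj) ?lie_G ?lie_J ?lie_L
  case lie_mem =>
    rintro y hy _ ⟨v, rfl⟩
    exact ⟨_, (lie_of hy v).symm⟩
  case lie_C₃ =>
    rintro _ ⟨v, rfl⟩
    rw [lie_of EHV.C₃_mem_parabolic, hC₃, map_smul]
  case lie_G_inj =>
    rintro _ ⟨v, rfl⟩ hv
    rw [LinearMap.mem_ker, LieModule.toEnd_apply_apply, lie_of (EHV.G_mem_parabolic (by omega)),
      ← map_zero (InducedModule.of _ V)] at hv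
    rw [hGinj ((of_inj hv).trans (lie_zero _).symm), map_zero]
  all_goals rintro i hi _ ⟨v, rfl⟩
  case lie_G => rw [lie_of (EHV.G_mem_parabolic (by omega)), hG i hi, map_zero]
  case lie_J => rw [lie_of (EHV.J_mem_parabolic (by omega)), hJ i hi, map_zero]
  case lie_L => rw [lie_of (EHV.L_mem_parabolic (by omega)), hL i hi, map_zero]
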